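/- Let $K$ be a field of characteristic $0$. For $d\ge 0$ let $G_d$ be the free bicommutative algebra of rank $d$ (free with respect to the identities $(x_1x_2)x_3=(x_1x_3)x_2$, $x_1(x_2x_3)=x_2(x_1x_3)$) in its following standard model: it is the nonassociative $K$-algebra with basis $\{x_1,\dots,x_d\}\cup\{Y^\gamma Z^\delta : |\gamma|,|\delta|\ge 1\}$, where $Y^\gamma Z^\delta=y_1^{\gamma_1}\cdots y_d^{\gamma_d}z_1^{\delta_1}\cdots z_d^{\delta_d}$ are monomials in commuting variables, and with multiplication $$x_ix_j=y_iz_j,\quad x_i\,(Y^\gamma Z^\delta)=y_iY^\gamma Z^\delta,\quad (Y^\gamma Z^\delta)\,x_i=Y^\gamma Z^\delta z_i,\quad (Y^\gamma Z^\delta)(Y^{\gamma'}Z^{\delta'})=Y^{\gamma+\gamma'}Z^{\delta+\delta'}.$$ It is graded by $\deg x_i=1$, $\deg Y^\gamma Z^\delta=|\gamma|+|\delta|$. A T-ideal of an algebra is a two-sided ideal stable under all endomorphisms; in an algebra, $g$ is a consequence of $f$ if $g$ lies in the T-ideal generated by $f$. Let $(\alpha_1,\alpha_2)\in K^2$, $(\alpha_1,\alpha_2)\ne(0,0)$,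 and let $\mathfrak U_\alpha$ be the variety of bicommutative algebras defined by the identity $\alpha_1x(xx)+\alpha_2(xx)x=0$. Let $G_d(\mathfrak U_\alpha)$ be the factor algebra of $G_d$ modulo the T-ideal generated by all values of $\alpha_1x(xx)+\alpha_2(xx)x$ in $G_d$, with the induced homogeneous components $G_d(\mathfrak U_\alpha)^{(n)}$. An element of $G_d(\mathfrak U_\alpha)$ is said to be of degree $n$ if it is the sum of a nonzero element of $G_d(\mathfrak U_\alpha)^{(n)}$ and of homogeneous elements of smaller degrees. Let $P_n(\mathfrak U_\alpha)\subset G_n(\mathfrak U_\alpha)$ be the space of multilinear elements of degree $n$, on which $S_n$ acts by $x_i\mapsto x_{\sigma(i)}$, and let $\chi_n(\mathfrak U_\alpha)$ be its character. Theorem. Suppose that $\alpha_1=\alpha_2$. Then: (0) $\chi_4(\mathfrak U_\alpha)=\chi_{(3,1)}$, the irreducible character of $S_4$ indexed by the partition $(3,1)$, and $\chi_n(\mathfrak U_\alpha)=0$ for all $n\ge5$. (i) For every $d$ and every $n\in\{1,2,3\}$, each element $f\in G_d(\mathfrak U_\alpha)$ of degree $n$ implies all polynomials of degree $n+1$: the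 whole component $G_d(\mathfrak U_\alpha)^{(n+1)}$ is contained in the T-ideal of $G_d(\mathfrak U_\alpha)$ generated by $f$. (ii) For every $d\ge 2$ the element $w_{(3,1)}^{(2)}=y_1^2(y_1z_2-y_2z_1)$ is nonzero in $G_d(\mathfrak U_\alpha)$ and has no consequences of higher degree: the T-ideal of $G_d(\mathfrak U_\alpha)$ generated by it contains no nonzero homogeneous element of degree greater than $4$. -/

import Mathlib

namespace Bicommutative

/-! ### T-ideals and factor algebras of nonassociative algebras -/

section TIdeals

variable (K : Type*) [Field K] {R : Type*} [NonUnitalNonAssocRing R] [Module K R]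

/-- A T-ideal of the (nonassociative) `K`-algebra `R`: a two-sided ideal which is stable under all
endomorphisms of `R`. -/
structure IsTIdeal (I : Submodule K R) : Prop where
  mul_left_mem : ∀ (a : R), ∀ b ∈ I, a * b ∈ I
  mul_right_mem : ∀ (a : R), ∀ b ∈ I, b * a ∈ I
  map_mem : ∀ (φ : R →ₙₐ[K] R), ∀ b ∈ I, φ b ∈ I

/-- The T-ideal of `R` generated by `S`. -/
def tIdeal (S : Set R) : Submodule K R := sInf {I | IsTIdeal K I ∧ S ⊆ I}

theorem isTIdeal_tIdeal (S : Set R) : IsTIdeal K (tIdeal K S) where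
  mul_left_mem a b hb := by
    simp only [tIdeal, Submodule.mem_sInf] at hb ⊢
    exact fun I hI => hI.1.mul_left_mem a b (hb I hI)
  mul_right_mem a b hb := by
    simp only [tIdeal, Submodule.mem_sInf] at hb ⊢
    exact fun I hI => hI.1.mul_right_mem a b (hb I hI)
  map_mem φ b hb := by
    simp only [tIdeal, Submodule.mem_sInf] at hb ⊢
    exact fun I hI => hI.1.map_mem φ b (hb I hI)

/-- The factor algebra of `R` modulo the T-ideal generated by `S`. -/
abbrev Factor (S : Set R) : Type _ := R ⧸ tIdeal K S

noncomputable instance (S : Set R) : Mul (Factor K S) where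
  mul := Quotient.map₂ (· * ·) (by
    intro a a' ha b b' hb
    have ha' := (Submodule.quotientRel_def _).1 ha
    have hb' := (Submodule.quotientRel_def _).1 hb
    refine (Submodule.quotientRel_def _).2 ?_
    have h : a * b - a' * b' = (a - a') * b + a' * (b - b') := by
      rw [sub_mul, mul_sub]; abel
    change a * b - a' * b' ∈ tIdeal K S
    rw [h]
    exact add_mem ((isTIdeal_tIdeal K S).mul_right_mem _ _ ha')
      ((isTIdeal_tIdeal K S).mul_left_mem _ _ hb'))

theorem factor_mk_mul (S : Set R) (a b : R) :
    (tIdeal K S).mkQ (a * b) = ((tIdeal K S).mkQ a * (tIdeal K S).mkQ b : Factor K S) := rfl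

noncomputable instance (S : Set R) : NonUnitalNonAssocRing (Factor K S) :=
  { (inferInstance : AddCommGroup (Factor K S)), (inferInstance : Mul (Factor K S)) with
    left_distrib := by
      intro a b c
      induction a using Submodule.Quotient.induction_on with | _ a
      induction b using Submodule.Quotient.induction_on with | _ b
      induction c using Submodule.Quotient.induction_on with | _ c
      exact congrArg (tIdeal K S).mkQ (mul_add a b c)
    right_distrib := by
      intro a b c
      induction a using Submodule.Quotient.induction_on with | _ a
      induction b using Submodule.Quotient.induction_on with | _ b
      induction c using Submodule.Quotient.induction_on with | _ c
      exact congrArg (tIdeal K S).mkQ (add_mul a b c)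
    zero_mul := by
      intro a
      induction a using Submodule.Quotient.induction_on with | _ a
      exact congrArg (tIdeal K S).mkQ (zero_mul a)
    mul_zero := by
      intro a
      induction a using Submodule.Quotient.induction_on with | _ a
      exact congrArg (tIdeal K S).mkQ (mul_zero a) }

end TIdeals

/-! ### The free bicommutative algebra `G_d` -/

open MvPolynomial

/-- The polynomial algebra `K[Y_d, Z_d]`: `Sum.inl i` is the index of `y_i` and `Sum.inr i` that
of `z_i`. -/
abbrev Poly (K : Type*) [Field K] (d : ℕ) : Type _ := MvPolynomial (Fin d ⊕ Fin d) K

section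

variable (K : Type*) [Field K] (d : ℕ)

/-- The variable `y_i`. -/
noncomputable abbrev y {d : ℕ} (i : Fin d) : Poly K d := X (Sum.inl i)

/-- The variable `z_i`. -/
noncomputable abbrev z {d : ℕ} (i : Fin d) : Poly K d := X (Sum.inr i)

/-- The ideal of `K[Y_d, Z_d]` generated by `y_1, …, y_d`. -/
noncomputable def idealY : Ideal (Poly K d) := Ideal.span (Set.range (y K))

/-- The ideal of `K[Y_d, Z_d]` generated by `z_1, …, z_d`. -/
noncomputable def idealZ : Ideal (Poly K d) := Ideal.span (Set.range (z K))

/-- The space `ω(K[Y_d]) ω(K[Z_d])`: the span of the monomials `Y^α Z^β` with `|α|, |β| ≥ 1`. -/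
noncomputable def sq : Ideal (Poly K d) := idealY K d * idealZ K d

/-- The vector space `G_d` with basis `X_d ∪ {Y^α Z^β : |α|, |β| ≥ 1}`; a pair `(c, u)` stands for
the element `c_1 x_1 + ⋯ + c_d x_d + u`. -/
def G : Type _ := (Fin d → K) × sq K d

namespace G

noncomputable instance : AddCommGroup (G K d) :=
  inferInstanceAs (AddCommGroup ((Fin d → K) × sq K d))

noncomputable instance : Module K (G K d) :=
  inferInstanceAs (Module K ((Fin d → K) × sq K d))

variable {K d}

/-- The coefficients of `x_1, …, x_d`. -/
def lin (a : G K d) : Fin d → K := a.1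

/-- The component in `ω(K[Y_d]) ω(K[Z_d])`. -/
def poly (a : G K d) : Poly K d := (a.2 : Poly K d)

/-- The element of `G_d` given by a polynomial in `ω(K[Y_d]) ω(K[Z_d])`. -/
def ofPoly (u : Poly K d) (hu : u ∈ sq K d) : G K d := (0, ⟨u, hu⟩)

/-- The generator `x_i`. -/
noncomputable def x (i : Fin d) : G K d := (Pi.single i 1, 0)

@[ext] theorem ext {a b : G K d} (h₁ : a.lin = b.lin) (h₂ : a.poly = b.poly) : a = b :=
  Prod.ext h₁ (Subtype.ext h₂)

theorem poly_mem (a : G K d) : a.poly ∈ sq K d := a.2.2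

/-- The linear map with `x_i ↦ y_i` which is the identity on `ω(K[Y_d]) ω(K[Z_d])`. -/
noncomputable def toY : G K d →ₗ[K] Poly K d where
  toFun a := ∑ i, a.lin i • y K i + a.poly
  map_add' a b := by
    change ∑ i, (a.lin i + b.lin i) • y K i + (a.poly + b.poly) = _
    simp only [add_smul, Finset.sum_add_distrib]
    abel
  map_smul' c a := by
    change ∑ i, (c * a.lin i) • y K i + c • a.poly = _
    simp only [mul_smul, smul_add, Finset.smul_sum, RingHom.id_apply]

/-- The linear map with `x_i ↦ z_i` which is the identity on `ω(K[Y_d]) ω(K[Z_d])`. -/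
noncomputable def toZ : G K d →ₗ[K] Poly K d where
  toFun a := ∑ i, a.lin i • z K i + a.poly
  map_add' a b := by
    change ∑ i, (a.lin i + b.lin i) • z K i + (a.poly + b.poly) = _
    simp only [add_smul, Finset.sum_add_distrib]
    abel
  map_smul' c a := by
    change ∑ i, (c * a.lin i) • z K i + c • a.poly = _
    simp only [mul_smul, smul_add, Finset.smul_sum, RingHom.id_apply]

theorem toY_mem (a : G K d) : a.toY ∈ idealY K d := by
  have h : sq K d ≤ idealY K d := Ideal.mul_le_left
  refine add_mem (sum_mem fun i _ => ?_) (h a.poly_mem)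
  rw [smul_eq_C_mul]
  exact Ideal.mul_mem_left _ _ (Ideal.subset_span ⟨i, rfl⟩)

theorem toZ_mem (a : G K d) : a.toZ ∈ idealZ K d := by
  have h : sq K d ≤ idealZ K d := Ideal.mul_le_right
  refine add_mem (sum_mem fun i _ => ?_) (h a.poly_mem)
  rw [smul_eq_C_mul]
  exact Ideal.mul_mem_left _ _ (Ideal.subset_span ⟨i, rfl⟩)

/-- The multiplication of `G_d`: for `u, v` in `ω(K[Y_d]) ω(K[Z_d])`,
`x_i x_j = y_i z_j`, `x_i u = y_i u`, `u x_j = u z_j`, and `u v` is the product of polynomials. -/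
noncomputable instance : Mul (G K d) where
  mul a b := ofPoly (a.toY * b.toZ) (Ideal.mul_mem_mul a.toY_mem b.toZ_mem)

theorem lin_mul (a b : G K d) : (a * b).lin = 0 := rfl

theorem poly_mul (a b : G K d) : (a * b).poly = a.toY * b.toZ := rfl

theorem poly_add (a b : G K d) : (a + b).poly = a.poly + b.poly := rfl

theorem lin_add (a b : G K d) : (a + b).lin = a.lin + b.lin := rfl

theorem poly_zero : (0 : G K d).poly = 0 := rfl

theorem lin_zero : (0 : G K d).lin = 0 := rfl

theorem poly_smul (c : K) (a : G K d) : (c • a).poly = c • a.poly := rfl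

theorem lin_smul (c : K) (a : G K d) : (c • a).lin = c • a.lin := rfl

noncomputable instance : NonUnitalNonAssocRing (G K d) :=
  { (inferInstance : AddCommGroup (G K d)), (inferInstance : Mul (G K d)) with
    left_distrib := fun a b c => by
      ext1
      · simp only [lin_mul, lin_add, add_zero]
      · simp only [poly_mul, poly_add, map_add, mul_add]
    right_distrib := fun a b c => by
      ext1
      · simp only [lin_mul, lin_add, add_zero]
      · simp only [poly_mul, poly_add, map_add, add_mul]
    zero_mul := fun a => by
      ext1
      · rfl
      · simp only [poly_mul, map_zero, zero_mul, poly_zero]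
    mul_zero := fun a => by
      ext1
      · rfl
      · simp only [poly_mul, map_zero, mul_zero, poly_zero] }

end G

/-- The homogeneous component of degree `n` of `G_d`: the `x_i` have degree `1` and `Y^α Z^β` has
degree `|α| + |β|`. -/
noncomputable def homG (n : ℕ) : Submodule K (G K d) where
  carrier := {a | (n ≠ 1 → a.lin = 0) ∧ a.poly.IsHomogeneous n}
  add_mem' {a b} ha hb :=
    ⟨fun h => by rw [G.lin_add, ha.1 h, hb.1 h, add_zero], ha.2.add hb.2⟩
  zero_mem' := ⟨fun _ => rfl, isHomogeneous_zero _ _ _⟩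
  smul_mem' c a ha :=
    ⟨fun h => by rw [G.lin_smul, ha.1 h, smul_zero], (homogeneousSubmodule _ _ n).smul_mem c ha.2⟩

/-- The space of multilinear elements of degree `n` of `G_n`: each of the `n` indices occurs exactly
once in each monomial. -/
noncomputable def multilinG (n : ℕ) : Submodule K (G K n) where
  carrier := {a | (n ≠ 1 → a.lin = 0) ∧
    ∀ m, coeff m a.poly ≠ 0 → ∀ i, m (Sum.inl i) + m (Sum.inr i) = 1}
  add_mem' {a b} ha hb := by
    refine ⟨fun h => by rw [G.lin_add, ha.1 h, hb.1 h, add_zero], fun m hm => ?_⟩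
    by_cases h : coeff m a.poly = 0
    · refine hb.2 m fun h' => hm ?_
      rw [G.poly_add, coeff_add, h, h', add_zero]
    · exact ha.2 m h
  zero_mem' := ⟨fun _ => rfl, fun m hm => absurd (by rw [G.poly_zero, coeff_zero]) hm⟩
  smul_mem' c a ha := by
    refine ⟨fun h => by rw [G.lin_smul, ha.1 h, smul_zero], fun m hm => ha.2 m fun h' => hm ?_⟩
    rw [G.poly_smul, coeff_smul, h', smul_zero]

variable {d} in
theorem rename_mem_sq (σ : Equiv.Perm (Fin d)) {u : Poly K d} (hu : u ∈ sq K d) :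
    rename (Sum.map σ σ) u ∈ sq K d := by
  have h : (sq K d).map (rename (Sum.map σ σ) : Poly K d →ₐ[K] Poly K d) ≤ sq K d := by
    rw [sq, Ideal.map_mul, idealY, idealZ, Ideal.map_span, Ideal.map_span]
    refine Ideal.mul_mono (Ideal.span_le.2 ?_) (Ideal.span_le.2 ?_)
    · rintro _ ⟨_, ⟨i, rfl⟩, rfl⟩
      exact Ideal.subset_span ⟨σ i, by simp⟩
    · rintro _ ⟨_, ⟨i, rfl⟩, rfl⟩
      exact Ideal.subset_span ⟨σ i, by simp⟩
  exact h (Ideal.mem_map_of_mem _ hu)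

variable {d} in
/-- The automorphism of `G_d` with `x_i ↦ x_{σ(i)}`. -/
noncomputable def permG (σ : Equiv.Perm (Fin d)) : G K d →ₙₐ[K] G K d where
  toFun a := (fun i => a.lin (σ.symm i), ⟨rename (Sum.map σ σ) a.poly, rename_mem_sq K σ a.poly_mem⟩)
  map_smul' c a := G.ext rfl (map_smul (rename (R := K) (Sum.map σ σ)) c a.poly)
  map_zero' := G.ext rfl (map_zero (rename (R := K) (Sum.map σ σ)))
  map_add' a b := G.ext rfl (map_add (rename (R := K) (Sum.map σ σ)) a.poly b.poly)
  map_mul' a b := by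
    refine G.ext rfl ?_
    change rename (Sum.map σ σ) (a.toY * b.toZ) =
      (∑ i, a.lin (σ.symm i) • y K i + rename (Sum.map σ σ) a.poly) *
        (∑ i, b.lin (σ.symm i) • z K i + rename (Sum.map σ σ) b.poly)
    rw [map_mul, ← Equiv.sum_comp σ (fun i => a.lin (σ.symm i) • y K i),
      ← Equiv.sum_comp σ (fun i => b.lin (σ.symm i) • z K i)]
    simp [G.toY, G.toZ]

variable {d} in
theorem permG_mem_multilinG (σ : Equiv.Perm (Fin d)) {a : G K d} (ha : a ∈ multilinG K d) :
    permG K σ a ∈ multilinG K d := by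
  refine ⟨fun h => ?_, fun m hm i => ?_⟩
  · funext i
    exact congrFun (ha.1 h) (σ.symm i)
  · obtain ⟨m', rfl, hm'⟩ := coeff_rename_ne_zero (Sum.map σ σ) a.poly m hm
    have hinj : Function.Injective (Sum.map σ σ) := σ.injective.sumMap σ.injective
    have h1 := Finsupp.mapDomain_apply hinj m' (Sum.inl (σ.symm i))
    have h2 := Finsupp.mapDomain_apply hinj m' (Sum.inr (σ.symm i))
    simp only [Sum.map_inl, Sum.map_inr, Equiv.apply_symm_apply] at h1 h2
    rw [h1, h2]
    exact ha.2 m' hm' (σ.symm i)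

variable {d} in
/-- The highest weight vector `y_1^j (y_1 z_2 - y_2 z_1)^{l₂} z_1^{l₁ - l₂ - j}` of `G_d`, where
`l₂ > 0` and `j ≤ l₁ - l₂`. -/
noncomputable def hwv (hd : 2 ≤ d) (l₁ l₂ j : ℕ) (hl : 0 < l₂) : G K d :=
  let i₁ : Fin d := ⟨0, by omega⟩
  let i₂ : Fin d := ⟨1, by omega⟩
  G.ofPoly (y K i₁ ^ j * (y K i₁ * z K i₂ - y K i₂ * z K i₁) ^ l₂ * z K i₁ ^ (l₁ - l₂ - j)) <| by
    have h : ∀ i k : Fin d, y K i * z K k ∈ sq K d := fun i k =>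
      Ideal.mul_mem_mul (Ideal.subset_span ⟨i, rfl⟩) (Ideal.subset_span ⟨k, rfl⟩)
    exact Ideal.mul_mem_right _ _ (Ideal.mul_mem_left _ _
      (Ideal.pow_mem_of_mem _ (sub_mem (h _ _) (h _ _)) _ hl))

/-! ### The variety `U_α` -/

/-- The values `α₁ v(vv) + α₂ (vv)v`, `v ∈ G_d`, of the polynomial `α₁ x(xx) + α₂ (xx)x`. -/
def identityU (α₁ α₂ : K) : Set (G K d) :=
  Set.range fun v : G K d => α₁ • (v * (v * v)) + α₂ • ((v * v) * v)

/-- `G_d(U_α)`: the factor algebra of `G_d` modulo the T-ideal generated by the identity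
`α₁ x(xx) + α₂ (xx)x = 0`. -/
abbrev GU (α₁ α₂ : K) : Type _ := Factor K (identityU K d α₁ α₂)

/-- The canonical projection `G_d → G_d(U_α)`. -/
noncomputable def toGU (α₁ α₂ : K) : G K d →ₗ[K] GU K d α₁ α₂ :=
  (tIdeal K (identityU K d α₁ α₂)).mkQ

/-- The homogeneous component of degree `n` of `G_d(U_α)`. -/
noncomputable def homGU (α₁ α₂ : K) (n : ℕ) : Submodule K (GU K d α₁ α₂) :=
  (homG K d n).map (toGU K d α₁ α₂)

variable {K d} in
/-- `f ∈ G_d(U_α)` is of degree `n`: it is the sum of a nonzero homogeneous element of degree `n`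
and of homogeneous elements of smaller degrees. -/
def HasDegree {α₁ α₂ : K} (f : GU K d α₁ α₂) (n : ℕ) : Prop :=
  ∃ u ∈ homGU K d α₁ α₂ n, u ≠ 0 ∧ f - u ∈ ⨆ k < n, homGU K d α₁ α₂ k

/-- The multilinear component `P_n(U_α)`. -/
noncomputable def multilinGU (α₁ α₂ : K) (n : ℕ) : Submodule K (GU K n α₁ α₂) :=
  (multilinG K n).map (toGU K n α₁ α₂)

variable {d} in
/-- The linear map of `G_d(U_α)` induced by `x_i ↦ x_{σ(i)}`. -/
noncomputable def permGU (α₁ α₂ : K) (σ : Equiv.Perm (Fin d)) :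
    GU K d α₁ α₂ →ₗ[K] GU K d α₁ α₂ :=
  (tIdeal K (identityU K d α₁ α₂)).mapQ (tIdeal K (identityU K d α₁ α₂))
    (permG K σ : G K d →ₗ[K] G K d)
    fun a ha => (isTIdeal_tIdeal K (identityU K d α₁ α₂)).map_mem (permG K σ) a ha

theorem permGU_mem_multilinGU (α₁ α₂ : K) (n : ℕ) (σ : Equiv.Perm (Fin n)) :
    ∀ f ∈ multilinGU K α₁ α₂ n, permGU K α₁ α₂ σ f ∈ multilinGU K α₁ α₂ n := by
  rintro _ ⟨a, ha, rfl⟩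
  exact ⟨permG K σ a, permG_mem_multilinG K σ ha, rfl⟩

/-- The cocharacter `χ_n(U_α)`: the character of the `S_n`-module `P_n(U_α)`. -/
noncomputable def cocharacter (α₁ α₂ : K) (n : ℕ) (σ : Equiv.Perm (Fin n)) : K :=
  LinearMap.trace K (multilinGU K α₁ α₂ n)
    ((permGU K α₁ α₂ σ).restrict (permGU_mem_multilinGU K α₁ α₂ n σ))

/-! ### Irreducible characters of the symmetric group -/

variable {K d} in
/-- The Specht polynomial of the tableau `T` of shape `μ`: the product of `t_p - t_q` over all
`p, q` in the same column of `T`, with `p` above `q`. -/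
noncomputable def spechtPoly {n : ℕ} {μ : YoungDiagram} (T : Fin n ≃ μ.cells) :
    MvPolynomial (Fin n) K :=
  ∏ pq : Fin n × Fin n with (T pq.1).1.2 = (T pq.2).1.2 ∧ (T pq.1).1.1 < (T pq.2).1.1,
    (X pq.1 - X pq.2)

/-- The Specht module of the Young diagram `μ` with `n` cells, spanned by the Specht polynomials
of all tableaux of shape `μ`. -/
noncomputable def spechtModule (μ : YoungDiagram) (n : ℕ) : Submodule K (MvPolynomial (Fin n) K) :=
  Submodule.span K (Set.range fun T : Fin n ≃ μ.cells => spechtPoly T)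

theorem rename_mem_spechtModule (μ : YoungDiagram) (n : ℕ) (σ : Equiv.Perm (Fin n)) :
    ∀ f ∈ spechtModule K μ n, (rename (R := K) σ).toLinearMap f ∈ spechtModule K μ n := by
  intro f hf
  refine (Submodule.span_le (p := (spechtModule K μ n).comap (rename (R := K) σ).toLinearMap)).2
    ?_ hf
  rintro _ ⟨T, rfl⟩
  refine Submodule.subset_span ⟨σ.symm.trans T, ?_⟩
  simp only [spechtPoly, AlgHom.toLinearMap_apply, map_prod, map_sub, rename_X]
  symm
  refine Finset.prod_equiv (σ.prodCongr σ) (fun pq => ?_) (fun pq _ => rfl)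
  rw [Finset.mem_filter, Finset.mem_filter]
  simp

/-- The irreducible character `χ_μ` of `S_n`, for a Young diagram `μ` with `n` cells. -/
noncomputable def irrChar (μ : YoungDiagram) (n : ℕ) (σ : Equiv.Perm (Fin n)) : K :=
  LinearMap.trace K (spechtModule K μ n)
    ((rename (R := K) σ).toLinearMap.restrict (rename_mem_spechtModule K μ n σ))

end

/-- The Young diagram of the partition `(3,1)`. -/
def shape31 : YoungDiagram := YoungDiagram.ofRowLens [3, 1] (by decide)

end Bicommutative

namespace Bicommutative

open MvPolynomial

section

variable {K : Type*} [Field K] {d : ℕ}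

/-! On the square of `G_d`, left and right multiplication by x_i act as multiplication by y_i and
z_i, and an endomorphism acts as the substitution `polyMap`. So the part of a T-ideal lying in the
square is an ideal of K[Y_d, Z_d] stable under these substitutions, and the T-ideal of the identity
becomes `cubicIdeal` (`mem_tIdeal_identityU`).

Upper bound: the polarization `cubicForm`, evaluated at generators and at one quadratic monomial,
gives the relations `CubicRel`. For four indices let T_i be z_i times the y's of the other three.
Then the T_i have sum zero, y_i z_j z_k z_l = -T_i and 2 y_i y_j z_k z_l = T_i + T_j. Hence degree
four is spanned by the T_i, and one further variable kills everything (`yyyyz` and its companions).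

Lower bound: the explicit linear map `wtMap` vanishes on `cubicIdeal` and commutes with permutations
of the indices. On multilinear elements it sends T_i to 4X_i - (X_1 + ... + X_4), which identifies
P_4 with the span of the X_p - X_q, the Specht module of (3,1). It also detects w_(3,1)^(2), which
has no consequences in degree above four because those components vanish.

Consequences of f: the endomorphism x_i ↦ 2x_i separates degrees, so the leading component of f lies
in its T-ideal (`exists_leading`). In degree two or three its polarization yields new multilinear
relations, strong enough to kill the next degree (`mem_of_isHomogeneous_two_mem`,
`yyyz_mem_of_form`). -/

/-- A subspace of a polynomial algebra which is closed under multiplication by the variables is an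
ideal. -/
def idealOfSubmodule {σ : Type*} (S : Submodule K (MvPolynomial σ K))
    (h : ∀ s, ∀ p ∈ S, X s * p ∈ S) : Ideal (MvPolynomial σ K) where
  carrier := S
  add_mem' := S.add_mem
  zero_mem' := S.zero_mem
  smul_mem' c p hp := by
    rw [smul_eq_mul]
    induction c using MvPolynomial.induction_on generalizing p with
    | C a => rw [← smul_eq_C_mul]; exact S.smul_mem a hp
    | add q r hq hr => rw [add_mul]; exact S.add_mem (hq _ hp) (hr _ hp)
    | mul_X q s hq => rw [mul_assoc]; exact hq _ (h s _ hp)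

theorem y_mul_z_mem_sq (i j : Fin d) : y K i * z K j ∈ sq K d :=
  Ideal.mul_mem_mul (Ideal.subset_span ⟨i, rfl⟩) (Ideal.subset_span ⟨j, rfl⟩)

theorem sq_le_of_forall {L : Ideal (Poly K d)} (h : ∀ i j, y K i * z K j ∈ L) : sq K d ≤ L := by
  rw [sq, idealY, idealZ, Ideal.span_mul_span', Ideal.span_le]
  rintro _ ⟨_, ⟨i, rfl⟩, _, ⟨j, rfl⟩, rfl⟩
  exact h i j

/-! ### Endomorphisms of `G_d` as substitutions in the polynomial algebra -/

namespace G

theorem toY_def (a : G K d) : a.toY = ∑ i, a.lin i • y K i + a.poly := rfl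

theorem toZ_def (a : G K d) : a.toZ = ∑ i, a.lin i • z K i + a.poly := rfl

theorem lin_x (i : Fin d) : (x i : G K d).lin = Pi.single i 1 := rfl

theorem poly_x (i : Fin d) : (x i : G K d).poly = 0 := rfl

theorem lin_ofPoly (u : Poly K d) (hu : u ∈ sq K d) : (ofPoly u hu).lin = 0 := rfl

theorem poly_ofPoly (u : Poly K d) (hu : u ∈ sq K d) : (ofPoly u hu).poly = u := rfl

theorem toY_x (i : Fin d) : (x i : G K d).toY = y K i := by
  simp [toY_def, lin_x, poly_x, Pi.single_apply]

theorem toZ_x (i : Fin d) : (x i : G K d).toZ = z K i := by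
  simp [toZ_def, lin_x, poly_x, Pi.single_apply]

theorem toY_of_lin_eq_zero {a : G K d} (h : a.lin = 0) : a.toY = a.poly := by
  simp [toY_def, h]

theorem toZ_of_lin_eq_zero {a : G K d} (h : a.lin = 0) : a.toZ = a.poly := by
  simp [toZ_def, h]

theorem toY_ofPoly (u : Poly K d) (hu : u ∈ sq K d) : (ofPoly u hu).toY = u :=
  toY_of_lin_eq_zero rfl

theorem toZ_ofPoly (u : Poly K d) (hu : u ∈ sq K d) : (ofPoly u hu).toZ = u :=
  toZ_of_lin_eq_zero rfl

theorem lin_sum {ι : Type*} (s : Finset ι) (f : ι → G K d) :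
    (∑ i ∈ s, f i).lin = ∑ i ∈ s, (f i).lin :=
  map_sum (⟨⟨lin, lin_zero⟩, lin_add⟩ : G K d →+ (Fin d → K)) f s

theorem poly_sum {ι : Type*} (s : Finset ι) (f : ι → G K d) :
    (∑ i ∈ s, f i).poly = ∑ i ∈ s, (f i).poly :=
  map_sum (⟨⟨poly, poly_zero⟩, poly_add⟩ : G K d →+ Poly K d) f s

theorem eq_sum_add_ofPoly (a : G K d) :
    a = ∑ i, a.lin i • x i + ofPoly a.poly a.poly_mem := by
  ext1
  · funext j
    simp [lin_add, lin_sum, lin_smul, lin_x, lin_ofPoly, Pi.single_apply]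
  · simp [poly_add, poly_sum, poly_smul, poly_x, poly_ofPoly]

/-- The endomorphism of `K[Y_d, Z_d]` which maps `y_i` to `toY (v i)` and `z_i` to `toZ (v i)`. -/
noncomputable def polyMap (v : Fin d → G K d) : Poly K d →ₐ[K] Poly K d :=
  aeval (Sum.elim (fun i => (v i).toY) fun i => (v i).toZ)

theorem polyMap_y (v : Fin d → G K d) (i : Fin d) : polyMap v (y K i) = (v i).toY := by
  simp [polyMap]

theorem polyMap_z (v : Fin d → G K d) (i : Fin d) : polyMap v (z K i) = (v i).toZ := by
  simp [polyMap]

theorem polyMap_mem_sq (v : Fin d → G K d) {u : Poly K d} (hu : u ∈ sq K d) :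
    polyMap v u ∈ sq K d := by
  have h : sq K d ≤ (sq K d).comap (polyMap v) := sq_le_of_forall fun i j => by
    rw [Ideal.mem_comap, map_mul, polyMap_y, polyMap_z]
    exact Ideal.mul_mem_mul (toY_mem _) (toZ_mem _)
  exact h hu

/-- The polynomials on which φ acts as this substitution form a subspace that contains y_i z_j = x_i
x_j. It is closed under y_i and z_i, since these are left and right multiplication by x_i, so it is
an ideal containing `sq`. -/
theorem exists_poly_map (φ : G K d →ₙₐ[K] G K d) {u : Poly K d} (hu : u ∈ sq K d) :
    ∃ a : G K d, a.lin = 0 ∧ a.poly = u ∧ (φ a).lin = 0 ∧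
      (φ a).poly = polyMap (fun i => φ (x i)) u := by
  let S : Submodule K (Poly K d) :=
    { carrier := {u | ∃ a : G K d, a.lin = 0 ∧ a.poly = u ∧ (φ a).lin = 0 ∧
        (φ a).poly = polyMap (fun i => φ (x i)) u}
      add_mem' := by
        rintro _ _ ⟨a, h1, rfl, h3, h4⟩ ⟨b, k1, rfl, k3, k4⟩
        exact ⟨a + b, by rw [lin_add, h1, k1, add_zero], rfl,
          by rw [map_add, lin_add, h3, k3, add_zero], by rw [map_add, poly_add, h4, k4, map_add]⟩
      zero_mem' := ⟨0, rfl, rfl, by rw [map_zero]; rfl, by rw [map_zero, map_zero]; rfl⟩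
      smul_mem' := by
        rintro c _ ⟨a, h1, rfl, h3, h4⟩
        exact ⟨c • a, by rw [lin_smul, h1, smul_zero], rfl,
          by rw [map_smul, lin_smul, h3, smul_zero],
          by rw [map_smul, poly_smul, h4, map_smul]⟩ }
  have hS : ∀ s, ∀ p ∈ S, X s * p ∈ S := by
    rintro (i | i) _ ⟨a, h1, rfl, h3, h4⟩
    · refine ⟨x i * a, rfl, ?_, by rw [map_mul]; rfl, ?_⟩
      · rw [poly_mul, toY_x, toZ_of_lin_eq_zero h1]
      · rw [map_mul, poly_mul, toZ_of_lin_eq_zero h3, h4, map_mul, polyMap_y]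
    · refine ⟨a * x i, rfl, ?_, by rw [map_mul]; rfl, ?_⟩
      · rw [poly_mul, toZ_x, toY_of_lin_eq_zero h1, mul_comm]
      · rw [map_mul, poly_mul, toY_of_lin_eq_zero h3, h4, map_mul, polyMap_z, mul_comm]
  have h : sq K d ≤ idealOfSubmodule S hS := sq_le_of_forall fun i j =>
    ⟨x i * x j, rfl, by rw [poly_mul, toY_x, toZ_x], by rw [map_mul]; rfl,
      by rw [map_mul, poly_mul, map_mul, polyMap_y, polyMap_z]⟩
  exact h hu

theorem lin_map_of_lin_eq_zero (φ : G K d →ₙₐ[K] G K d) {a : G K d} (h : a.lin = 0) :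
    (φ a).lin = 0 := by
  obtain ⟨b, h1, h2, h3, -⟩ := exists_poly_map φ a.poly_mem
  rwa [show a = b from G.ext (h.trans h1.symm) h2.symm]

theorem poly_map_of_lin_eq_zero (φ : G K d →ₙₐ[K] G K d) {a : G K d} (h : a.lin = 0) :
    (φ a).poly = polyMap (fun i => φ (x i)) a.poly := by
  obtain ⟨b, h1, h2, -, h4⟩ := exists_poly_map φ a.poly_mem
  rw [show a = b from G.ext (h.trans h1.symm) h2.symm, h4, h2]

theorem toY_map (φ : G K d →ₙₐ[K] G K d) (a : G K d) :
    (φ a).toY = polyMap (fun i => φ (x i)) a.toY := by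
  conv_lhs => rw [eq_sum_add_ofPoly a]
  rw [map_add, map_add, toY_of_lin_eq_zero (lin_map_of_lin_eq_zero φ (lin_ofPoly _ _)),
    poly_map_of_lin_eq_zero φ (lin_ofPoly _ _), toY_def a]
  simp [polyMap_y, poly_ofPoly]

theorem toZ_map (φ : G K d →ₙₐ[K] G K d) (a : G K d) :
    (φ a).toZ = polyMap (fun i => φ (x i)) a.toZ := by
  conv_lhs => rw [eq_sum_add_ofPoly a]
  rw [map_add, map_add, toZ_of_lin_eq_zero (lin_map_of_lin_eq_zero φ (lin_ofPoly _ _)),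
    poly_map_of_lin_eq_zero φ (lin_ofPoly _ _), toZ_def a]
  simp [polyMap_z, poly_ofPoly]

/-- The endomorphism of `G_d` with `x_i ↦ v i`. -/
noncomputable def subst (v : Fin d → G K d) : G K d →ₙₐ[K] G K d where
  toFun a := ∑ i, a.lin i • v i + ofPoly (polyMap v a.poly) (polyMap_mem_sq v a.poly_mem)
  map_smul' c a := by
    ext1 <;> simp [lin_add, lin_sum, lin_smul, lin_ofPoly, poly_add, poly_sum, poly_smul,
      poly_ofPoly, Finset.smul_sum, mul_smul]
  map_zero' := by
    ext1 <;> simp [lin_ofPoly, poly_ofPoly, poly_zero, lin_zero]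
  map_add' a b := by
    ext1 <;> simp [lin_add, lin_sum, lin_smul, lin_ofPoly, poly_add, poly_sum, poly_smul,
      poly_ofPoly, add_smul, Finset.sum_add_distrib]
    all_goals abel
  map_mul' a b := by
    ext1
    · simp [lin_ofPoly, lin_mul]
    · simp [poly_ofPoly, lin_mul, poly_mul, toY_ofPoly, toZ_ofPoly]
      rw [toY_def a, toZ_def b]
      simp [polyMap_y, polyMap_z]

theorem subst_apply (v : Fin d → G K d) (a : G K d) :
    subst v a = ∑ i, a.lin i • v i + ofPoly (polyMap v a.poly) (polyMap_mem_sq v a.poly_mem) :=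
  rfl

theorem lin_subst_of_lin_eq_zero (v : Fin d → G K d) {a : G K d} (h : a.lin = 0) :
    (subst v a).lin = 0 := by
  simp [subst_apply, h, lin_ofPoly]

theorem poly_subst_of_lin_eq_zero (v : Fin d → G K d) {a : G K d} (h : a.lin = 0) :
    (subst v a).poly = polyMap v a.poly := by
  simp [subst_apply, h, poly_ofPoly]

end G

open G

/-! ### T-ideals of `G_d` and ideals of `K[Y_d, Z_d]` -/

/-- The polynomials in a T-ideal of `G_d`. -/
def polyIdeal {N : Submodule K (G K d)} (hN : IsTIdeal K N) : Ideal (Poly K d) :=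
  idealOfSubmodule
    { carrier := {u | ∃ a ∈ N, a.lin = 0 ∧ a.poly = u}
      add_mem' := by
        rintro _ _ ⟨a, h1, h2, rfl⟩ ⟨b, k1, k2, rfl⟩
        exact ⟨a + b, N.add_mem h1 k1, by rw [lin_add, h2, k2, add_zero], rfl⟩
      zero_mem' := ⟨0, N.zero_mem, rfl, rfl⟩
      smul_mem' := by
        rintro c _ ⟨a, h1, h2, rfl⟩
        exact ⟨c • a, N.smul_mem c h1, by rw [lin_smul, h2, smul_zero], rfl⟩ } <| by
    rintro (i | i) _ ⟨a, h1, h2, rfl⟩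
    · exact ⟨x i * a, hN.mul_left_mem _ _ h1, rfl,
        by rw [poly_mul, toY_x, toZ_of_lin_eq_zero h2]⟩
    · exact ⟨a * x i, hN.mul_right_mem _ _ h1, rfl,
        by rw [poly_mul, toZ_x, toY_of_lin_eq_zero h2, mul_comm]⟩

theorem mem_of_poly_mem {N : Submodule K (G K d)} (hN : IsTIdeal K N) {a : G K d}
    (h : a.lin = 0) (hp : a.poly ∈ polyIdeal hN) : a ∈ N := by
  obtain ⟨b, hb, h1, h2⟩ := hp
  rwa [show a = b from G.ext (h.trans h1.symm) h2.symm]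

theorem poly_mem_polyIdeal {N : Submodule K (G K d)} (hN : IsTIdeal K N) {a : G K d}
    (h : a.lin = 0) (ha : a ∈ N) : a.poly ∈ polyIdeal hN := ⟨a, ha, h, rfl⟩

theorem polyMap_mem_polyIdeal {N : Submodule K (G K d)} (hN : IsTIdeal K N) (v : Fin d → G K d)
    {u : Poly K d} (hu : u ∈ polyIdeal hN) : polyMap v u ∈ polyIdeal hN := by
  obtain ⟨a, ha, h, rfl⟩ := hu
  exact ⟨subst v a, hN.map_mem _ _ ha, lin_subst_of_lin_eq_zero v h,
    poly_subst_of_lin_eq_zero v h⟩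

/-! ### The T-ideal generated by the identity -/

/-- The polynomial of `g(gg) + (gg)g`. -/
noncomputable def cubic (g : G K d) : Poly K d := g.toY * g.toZ * (g.toY + g.toZ)

variable (K d) in
/-- The ideal of `K[Y_d, Z_d]` generated by the polynomials of all `g(gg) + (gg)g`. -/
noncomputable def cubicIdeal : Ideal (Poly K d) := Ideal.span (Set.range cubic)

theorem cubic_mem (g : G K d) : cubic g ∈ cubicIdeal K d := Ideal.subset_span ⟨g, rfl⟩

theorem poly_identity (α : K) (g : G K d) :
    (α • (g * (g * g)) + α • ((g * g) * g)).poly = α • cubic g := by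
  rw [poly_add, poly_smul, poly_smul, poly_mul, poly_mul, toZ_of_lin_eq_zero (lin_mul g g),
    toY_of_lin_eq_zero (lin_mul g g), poly_mul, cubic, ← smul_add]
  congr 1
  ring

/-- The elements of `G_d` given by polynomials in `cubicIdeal`. -/
def cubicTIdeal : Submodule K (G K d) where
  carrier := {a | a.lin = 0 ∧ a.poly ∈ cubicIdeal K d}
  add_mem' ha hb := ⟨by rw [lin_add, ha.1, hb.1, add_zero], add_mem ha.2 hb.2⟩
  zero_mem' := ⟨rfl, zero_mem _⟩
  smul_mem' c a ha := ⟨by rw [lin_smul, ha.1, smul_zero], by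
    rw [poly_smul, smul_eq_C_mul]; exact Ideal.mul_mem_left _ _ ha.2⟩

theorem isTIdeal_cubicTIdeal : IsTIdeal K (cubicTIdeal : Submodule K (G K d)) where
  mul_left_mem a b hb := ⟨rfl, by
    rw [poly_mul, toZ_of_lin_eq_zero hb.1]; exact Ideal.mul_mem_left _ _ hb.2⟩
  mul_right_mem a b hb := ⟨rfl, by
    rw [poly_mul, toY_of_lin_eq_zero hb.1]; exact Ideal.mul_mem_right _ _ hb.2⟩
  map_mem φ b hb := by
    refine ⟨lin_map_of_lin_eq_zero φ hb.1, ?_⟩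
    rw [poly_map_of_lin_eq_zero φ hb.1]
    have h : cubicIdeal K d ≤ (cubicIdeal K d).comap (polyMap fun i => φ (x i)) := by
      refine Ideal.span_le.2 ?_
      rintro _ ⟨g, rfl⟩
      change polyMap (fun i => φ (x i)) (cubic g) ∈ cubicIdeal K d
      -- The construction is natural: the substitution induced by φ carries the generator of g to
      -- that of φ g.
      rw [cubic, map_mul, map_mul, map_add, ← toY_map, ← toZ_map]
      exact cubic_mem (φ g)
    exact h hb.2

theorem mem_tIdeal_self {R : Type*} [NonUnitalNonAssocRing R] [Module K R] {S : Set R} {a : R}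
    (h : a ∈ S) : a ∈ tIdeal K S := Submodule.mem_sInf.2 fun _ hI => hI.2 h

theorem lin_identity (α β : K) (g : G K d) :
    (α • (g * (g * g)) + β • ((g * g) * g)).lin = 0 := by
  simp [lin_add, lin_smul, lin_mul]

theorem cubicIdeal_le_polyIdeal {α : K} (hα : α ≠ 0) {N : Submodule K (G K d)}
    (hN : IsTIdeal K N) (h : identityU K d α α ⊆ N) : cubicIdeal K d ≤ polyIdeal hN := by
  refine Ideal.span_le.2 ?_
  rintro _ ⟨g, rfl⟩
  have h3 : α • cubic g ∈ polyIdeal hN := by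
    rw [← poly_identity]
    exact poly_mem_polyIdeal _ (lin_identity α α g) (h ⟨g, rfl⟩)
  have h4 := Ideal.mul_mem_left _ (C α⁻¹) h3
  rwa [← smul_eq_C_mul, inv_smul_smul₀ hα] at h4

theorem mem_tIdeal_identityU {α : K} (hα : α ≠ 0) {a : G K d} :
    a ∈ tIdeal K (identityU K d α α) ↔ a.lin = 0 ∧ a.poly ∈ cubicIdeal K d := by
  constructor
  · intro ha
    refine (Submodule.mem_sInf.1 ha) cubicTIdeal ⟨isTIdeal_cubicTIdeal, ?_⟩
    rintro _ ⟨g, rfl⟩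
    refine ⟨lin_identity α α g, ?_⟩
    rw [poly_identity, smul_eq_C_mul]
    exact Ideal.mul_mem_left _ _ (cubic_mem g)
  · rintro ⟨h1, h2⟩
    exact mem_of_poly_mem (isTIdeal_tIdeal K _) h1
      (cubicIdeal_le_polyIdeal hα _ (fun _ => mem_tIdeal_self) h2)

/-- The endomorphism of a factor algebra induced by an endomorphism. -/
noncomputable def factorMap {R : Type*} [NonUnitalNonAssocRing R] [Module K R] (S : Set R)
    (φ : R →ₙₐ[K] R) : Factor K S →ₙₐ[K] Factor K S :=
  { (tIdeal K S).mapQ (tIdeal K S) (φ : R →ₗ[K] R)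
      fun a ha => (isTIdeal_tIdeal K S).map_mem φ a ha with
    map_zero' := map_zero _
    map_mul' := by
      intro a b
      induction a using Submodule.Quotient.induction_on with | _ a
      induction b using Submodule.Quotient.induction_on with | _ b
      exact congrArg (tIdeal K S).mkQ (map_mul φ a b) }

/-- Endomorphisms of `R` descend to the factor algebra because the T-ideal is stable under them;
consequences in the factor algebra can therefore be computed in `R`. -/
theorem IsTIdeal.comap_mkQ {R : Type*} [NonUnitalNonAssocRing R] [Module K R] {S : Set R}
    {N : Submodule K (Factor K S)} (hN : IsTIdeal K N) :
    IsTIdeal K (N.comap (tIdeal K S).mkQ) where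
  mul_left_mem a _ hb := hN.mul_left_mem ((tIdeal K S).mkQ a) _ hb
  mul_right_mem a _ hb := hN.mul_right_mem ((tIdeal K S).mkQ a) _ hb
  map_mem φ _ hb := hN.map_mem (factorMap S φ) _ hb

end

/-! ### Consequences of the identity in commutative rings -/

section Relations

variable {Q : Type*} [CommRing Q] {ι : Type*}

/-- The relations which the images `y i`, `z i` of the variables satisfy in a commutative ring
where the polynomials of the linearization of `x(xx) + (xx)x` vanish, for values of degree at most
two. -/
structure CubicRel (y z : ι → Q) : Prop where
  two_mul_eq_zero : ∀ t : Q, 2 * t = 0 → t = 0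
  three_mul_eq_zero : ∀ t : Q, 3 * t = 0 → t = 0
  rel₃ : ∀ i j k, y i * y j * z k + y i * y k * z j + y j * y k * z i + y i * z j * z k +
    y j * z i * z k + y k * z i * z j = 0
  rel₄ : ∀ i j k l, y i * z j * (y k * y l + 2 * (y k * z l) + 2 * (y l * z k) + z k * z l) = 0

namespace CubicRel

variable {y z : ι → Q}

/-- In degree four, `rel₃` times a variable and `rel₄` form a linear system in the monomials. This
lemma and the next two solve it in terms of the products yyyz, with 3 as denominator. -/
theorem sum_yyyz (h : CubicRel y z) (i j k l : ι) : y j * y k * y l * z i + y i * y k * y l * z j +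
    y i * y j * y l * z k + y i * y j * y k * z l = 0 := by
  apply h.three_mul_eq_zero _
  linear_combination 3 * y i * h.rel₃ j k l - 4 * z i * h.rel₃ j k l + y j * h.rel₃ i k l +
    2 * z j * h.rel₃ i k l + y k * h.rel₃ i j l + 2 * z k * h.rel₃ i j l + y l * h.rel₃ i j k +
    2 * z l * h.rel₃ i j k - 2 * h.rel₄ i j k l - 2 * h.rel₄ i k j l - 2 * h.rel₄ i l j k

theorem yyyz_add_yzzz (h : CubicRel y z) (i j k l : ι) : y j * y k * y l * z i + y i * z j * z k * z l = 0 := by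
  apply h.three_mul_eq_zero _
  linear_combination -y i * h.rel₃ j k l - 4 * z i * h.rel₃ j k l + y j * h.rel₃ i k l +
    2 * z j * h.rel₃ i k l + y k * h.rel₃ i j l + 2 * z k * h.rel₃ i j l + y l * h.rel₃ i j k +
    2 * z l * h.rel₃ i j k - h.rel₄ i j k l - h.rel₄ i k j l - h.rel₄ i l j k

theorem two_yyzz (h : CubicRel y z) (i j k l : ι) : 2 * (y i * y j * z k * z l) =
    y j * y k * y l * z i + y i * y k * y l * z j := by
  rw [← sub_eq_zero]
  apply h.three_mul_eq_zero _
  linear_combination -y i * h.rel₃ j k l + 4 * z i * h.rel₃ j k l - y j * h.rel₃ i k l -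
    2 * z j * h.rel₃ i k l - y k * h.rel₃ i j l - 2 * z k * h.rel₃ i j l - y l * h.rel₃ i j k -
    2 * z l * h.rel₃ i j k + 3 * h.rel₄ i k j l + 3 * h.rel₄ i l j k

/-- Expanding 2 y_a y_b y_c z_e z_f by `two_yyzz` after setting aside y_a, or y_b, shows that the
index of z may be exchanged with that of any y. So the four terms of y_m times `sum_yyyz` coincide,
and 4 is cancelled as 2 · 2. -/
theorem yyyyz (h : CubicRel y z) (i j k l m : ι) : y j * y k * y l * y m * z i = 0 := by
  have e : ∀ a b c e f, y b * y c * y e * y f * z a = y a * y c * y e * y f * z b :=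
    fun a b c e f => by
      linear_combination y a * h.two_yyzz b c e f - y b * h.two_yyzz a c e f
  apply h.two_mul_eq_zero _
  apply h.two_mul_eq_zero _
  linear_combination y m * h.sum_yyyz i j k l + e i j k l m + e i k j l m + e i l j k m

theorem yyyzz (h : CubicRel y z) (i j k l m : ι) : y i * y j * y m * z k * z l = 0 := by
  apply h.two_mul_eq_zero _
  linear_combination y m * h.two_yyzz i j k l + h.yyyyz i j k l m + h.yyyyz j i k l m

theorem yyzzz (h : CubicRel y z) (i j k l m : ι) : y i * y j * z k * z l * z m = 0 := by
  apply h.two_mul_eq_zero _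
  linear_combination z m * h.two_yyzz i j k l + h.yyyzz j k i m l + h.yyyzz i k j m l

theorem yzzzz (h : CubicRel y z) (i j k l m : ι) : y i * z j * z k * z l * z m = 0 := by
  linear_combination z m * h.yyyz_add_yzzz i j k l - h.yyyzz j k i m l


/-! ### Effect of an additional relation of degree three -/

/-- Multiplied by y_i, the extra relation is the sum in `sum_yyyz` without its first term. -/
theorem yyyz_of_symm (h : CubicRel y z)
    (hs : ∀ i j k, y i * y j * z k + y i * y k * z j + y j * y k * z i = 0) (i j k l : ι) :
    y j * y k * y l * z i = 0 := by
  linear_combination h.sum_yyyz i j k l - y i * hs j k l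

/-- By `two_yyzz`, the extra relations become a scalar times the difference of two products yyyz:
the scalar is s + t if `h₄` is used, and t - 2s (up to sign) if `h₃` is multiplied by y_l. As soon
as one of the scalars can be cancelled, all four products agree, and their sum is zero. -/
theorem yyyz_of_alt (h : CubicRel y z) {s t : Q}
    (hst : (∀ q : Q, (s + t) * q = 0 → q = 0) ∨ ∀ q : Q, (t - 2 * s) * q = 0 → q = 0)
    (h₃ : ∀ i j k, (s * y k + t * z k) * (y i * z j - y j * z i) = 0)
    (h₄ : ∀ i j k l, (s + t) * (y k * z l) * (y i * z j - y j * z i) = 0) (i j k l : ι) :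
    y j * y k * y l * z i = 0 := by
  have e : ∀ i j k l, y j * y k * y l * z i = y i * y k * y l * z j := by
    intro i j k l
    rw [← sub_eq_zero]
    rcases hst with hst | hst
    · apply hst
      linear_combination 2 * h₄ i j k l - (s + t) * h.two_yyzz k i l j +
        (s + t) * h.two_yyzz k j l i
    · apply hst
      linear_combination 2 * y l * h₃ i j k - t * h.two_yyzz l i k j + t * h.two_yyzz l j k i
  apply h.two_mul_eq_zero _
  apply h.two_mul_eq_zero _
  linear_combination h.sum_yyyz i j k l + e i j k l + e i k j l + e i l j k

theorem yyzz_of_yyyz (h : CubicRel y z) (hT : ∀ i j k l, y j * y k * y l * z i = 0)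
    (i j k l : ι) : y i * y j * z k * z l = 0 := by
  apply h.two_mul_eq_zero _
  linear_combination h.two_yyzz i j k l + hT i j k l + hT j i k l

theorem yzzz_of_yyyz (h : CubicRel y z) (hT : ∀ i j k l, y j * y k * y l * z i = 0)
    (i j k l : ι) : y i * z j * z k * z l = 0 := by
  linear_combination h.yyyz_add_yzzz i j k l - hT i j k l

end CubicRel
end Relations
open MvPolynomial G

section

variable {K : Type*} [Field K] {d : ℕ}

/-! ### Homogeneous polynomials in `ω(K[Y_d]) ω(K[Z_d])` -/

theorem exists_of_mem_sq {p : Poly K d} (hp : p ∈ sq K d) {m : Fin d ⊕ Fin d →₀ ℕ}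
    (hm : coeff m p ≠ 0) :
    ∃ i j m', m = Finsupp.single (Sum.inl i) 1 + Finsupp.single (Sum.inr j) 1 + m' := by
  have hY : p ∈ Ideal.span ((X : _ → Poly K d) '' Set.range Sum.inl) := by
    rw [← Set.range_comp]; exact (Ideal.mul_le_left : sq K d ≤ idealY K d) hp
  have hZ : p ∈ Ideal.span ((X : _ → Poly K d) '' Set.range Sum.inr) := by
    rw [← Set.range_comp]; exact (Ideal.mul_le_right : sq K d ≤ idealZ K d) hp
  obtain ⟨_, ⟨i, rfl⟩, hi⟩ := mem_ideal_span_X_image.1 hY m (mem_support_iff.2 hm)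
  obtain ⟨_, ⟨j, rfl⟩, hj⟩ := mem_ideal_span_X_image.1 hZ m (mem_support_iff.2 hm)
  refine ⟨i, j, m - (Finsupp.single (Sum.inl i) 1 + Finsupp.single (Sum.inr j) 1), ?_⟩
  rw [add_tsub_cancel_of_le]
  intro s
  rcases s with s | s
  · by_cases h : i = s
    · subst h; simp; omega
    · simp [h]
  · by_cases h : j = s
    · subst h; simp; omega
    · simp [h]

theorem degree_eq_of_isHomogeneous {σ : Type*} {p : MvPolynomial σ K} {n : ℕ}
    (hn : p.IsHomogeneous n) {m : σ →₀ ℕ} (hm : coeff m p ≠ 0) : m.degree = n := by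
  rw [Finsupp.degree_eq_weight_one]; exact hn hm

theorem mem_of_forall_monomial_mem (S : Submodule K (Poly K d)) {p : Poly K d} {n : ℕ}
    (hp : p ∈ sq K d) (hn : p.IsHomogeneous n)
    (h : ∀ i j m, Finsupp.degree m + 2 = n → y K i * z K j * monomial m 1 ∈ S) : p ∈ S := by
  rw [p.as_sum]
  refine S.sum_mem fun m hm => ?_
  rw [mem_support_iff] at hm
  obtain ⟨i, j, m', e⟩ := exists_of_mem_sq hp hm
  have hd := degree_eq_of_isHomogeneous hn hm
  have := S.smul_mem (coeff m p) (h i j m' (by rw [← hd, e]; simp; omega))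
  convert this using 1
  conv_lhs => rw [e]
  rw [y, z, X, X, monomial_mul, monomial_mul, smul_monomial]
  simp [← e]

theorem exists_monomial_eq_X_mul {σ : Type*} {m : σ →₀ ℕ} {k : ℕ} (h : m.degree = k + 1) :
    ∃ s m', Finsupp.degree m' = k ∧ (monomial m 1 : MvPolynomial σ K) = X s * monomial m' 1 := by
  classical
  have : m ≠ 0 := by rintro rfl; simp at h
  obtain ⟨s, hs⟩ := Finsupp.ne_iff.1 this
  have e : m = Finsupp.single s 1 + (m - Finsupp.single s 1) := by
    rw [add_tsub_cancel_of_le]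
    rw [Finsupp.single_le_iff]
    exact Nat.one_le_iff_ne_zero.2 hs
  refine ⟨s, m - Finsupp.single s 1, ?_, ?_⟩
  · rw [e] at h; simp at h; omega
  · rw [X, monomial_mul, ← e, one_mul]

/-! ### The linearized identity -/

/-- The linearization of `cubic`. -/
noncomputable def cubicForm (g₁ g₂ g₃ : G K d) : Poly K d :=
  g₁.toY * g₂.toY * g₃.toZ + g₁.toY * g₃.toY * g₂.toZ + g₂.toY * g₃.toY * g₁.toZ +
    g₁.toY * g₂.toZ * g₃.toZ + g₂.toY * g₁.toZ * g₃.toZ + g₃.toY * g₁.toZ * g₂.toZ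

theorem mem_of_C_mul_mem {L : Ideal (Poly K d)} {c : K} (hc : c ≠ 0) {p : Poly K d}
    (h : C c * p ∈ L) : p ∈ L := by
  have := L.mul_mem_left (C c⁻¹) h
  rwa [← mul_assoc, ← C_mul, inv_mul_cancel₀ hc, C_1, one_mul] at this

theorem eq_zero_of_mk_C_mul {L : Ideal (Poly K d)} {c : K} (hc : c ≠ 0) (q : Poly K d ⧸ L)
    (h : Ideal.Quotient.mk L (C c) * q = 0) : q = 0 := by
  obtain ⟨p, rfl⟩ := Ideal.Quotient.mk_surjective q
  rw [← map_mul, Ideal.Quotient.eq_zero_iff_mem] at h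
  exact Ideal.Quotient.eq_zero_iff_mem.2 (mem_of_C_mul_mem hc h)

variable [CharZero K]

theorem cubicForm_mem (g₁ g₂ g₃ : G K d) : cubicForm g₁ g₂ g₃ ∈ cubicIdeal K d := by
  refine mem_of_C_mul_mem (two_ne_zero : (2 : K) ≠ 0) ?_
  -- Inclusion–exclusion yields the full polarization, in which each of the six products occurs
  -- twice.
  have e : C 2 * cubicForm g₁ g₂ g₃ = cubic (g₁ + g₂ + g₃) - cubic (g₁ + g₂) - cubic (g₁ + g₃) -
      cubic (g₂ + g₃) + cubic g₁ + cubic g₂ + cubic g₃ := by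
    simp only [cubicForm, cubic, map_add, map_ofNat]
    ring
  rw [e]
  have h := cubic_mem (K := K) (d := d)
  exact add_mem (add_mem (add_mem (sub_mem (sub_mem (sub_mem (h _) (h _)) (h _)) (h _)) (h _))
    (h _)) (h _)

theorem cubicRel {L : Ideal (Poly K d)} (hL : cubicIdeal K d ≤ L) :
    CubicRel (fun i => Ideal.Quotient.mk L (y K i)) fun i => Ideal.Quotient.mk L (z K i) where
  two_mul_eq_zero t h := eq_zero_of_mk_C_mul (two_ne_zero : (2 : K) ≠ 0) t
    (by rwa [map_ofNat C 2, map_ofNat])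
  three_mul_eq_zero t h := eq_zero_of_mk_C_mul (three_ne_zero : (3 : K) ≠ 0) t
    (by rwa [map_ofNat C 3, map_ofNat])
  rel₃ i j k := by
    have := Ideal.Quotient.eq_zero_iff_mem.2 (hL (cubicForm_mem (G.x i) (G.x j) (G.x k)))
    simpa only [cubicForm, toY_x, toZ_x, map_add, map_mul] using this
  -- For u = y_i z_j both `toY` and `toZ` give u, so u factors out of all six terms.
  rel₄ i j k l := by
    have := Ideal.Quotient.eq_zero_iff_mem.2
      (hL (cubicForm_mem (ofPoly _ (y_mul_z_mem_sq i j)) (G.x k) (G.x l)))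
    simp only [cubicForm, toY_x, toZ_x, toY_ofPoly, toZ_ofPoly, map_add, map_mul] at this
    linear_combination this

/-- Each monomial has a factor y_i z_j times three more variables, and all products of that kind of
degree five vanish modulo the ideal. -/
theorem mem_cubicIdeal_of_isHomogeneous {p : Poly K d} {n : ℕ} (h5 : 5 ≤ n) (hp : p ∈ sq K d)
    (hn : p.IsHomogeneous n) : p ∈ cubicIdeal K d := by
  refine mem_of_forall_monomial_mem ((cubicIdeal K d).restrictScalars K) hp hn fun i j m hm => ?_
  obtain ⟨a, m₁, h₁, e₁⟩ := exists_monomial_eq_X_mul (K := K)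
    (show Finsupp.degree m = (n - 3) + 1 by omega)
  obtain ⟨b, m₂, h₂, e₂⟩ := exists_monomial_eq_X_mul (K := K)
    (show Finsupp.degree m₁ = (n - 4) + 1 by omega)
  obtain ⟨c, m₃, h₃, e₃⟩ := exists_monomial_eq_X_mul (K := K)
    (show Finsupp.degree m₂ = (n - 5) + 1 by omega)
  rw [e₁, e₂, e₃, Submodule.restrictScalars_mem]
  have h := cubicRel (le_refl (cubicIdeal K d))
  suffices y K i * z K j * X a * X b * X c ∈ cubicIdeal K d by
    convert Ideal.mul_mem_right (monomial m₃ 1) _ this using 1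
    ring
  rw [← Ideal.Quotient.eq_zero_iff_mem]
  simp only [map_mul]
  rcases a with a | a <;> rcases b with b | b <;> rcases c with c | c
  · linear_combination h.yyyyz j i a b c
  · linear_combination h.yyyzz i a j c b
  · linear_combination h.yyyzz i a j b c
  · linear_combination h.yyzzz i a j b c
  · linear_combination h.yyyzz i b j a c
  · linear_combination h.yyzzz i b j a c
  · linear_combination h.yyzzz i c j a b
  · linear_combination h.yzzzz i j a b c

theorem mem_of_isHomogeneous_four {L : Ideal (Poly K d)} (hL : cubicIdeal K d ≤ L)
    (hT : ∀ i j k l, y K j * y K k * y K l * z K i ∈ L) {p : Poly K d} (hp : p ∈ sq K d)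
    (hn : p.IsHomogeneous 4) : p ∈ L := by
  refine mem_of_forall_monomial_mem (L.restrictScalars K) hp hn fun i j m hm => ?_
  obtain ⟨a, m₁, h₁, e₁⟩ := exists_monomial_eq_X_mul (K := K)
    (show Finsupp.degree m = 1 + 1 by omega)
  obtain ⟨b, m₂, h₂, e₂⟩ := exists_monomial_eq_X_mul (K := K)
    (show Finsupp.degree m₁ = 0 + 1 by omega)
  rw [e₁, e₂, Submodule.restrictScalars_mem]
  have h := cubicRel hL
  have hT' : ∀ i j k l, Ideal.Quotient.mk L (y K j) * Ideal.Quotient.mk L (y K k) *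
      Ideal.Quotient.mk L (y K l) * Ideal.Quotient.mk L (z K i) = 0 := fun i j k l => by
    simp only [← map_mul]; exact Ideal.Quotient.eq_zero_iff_mem.2 (hT i j k l)
  suffices y K i * z K j * X a * X b ∈ L by
    convert Ideal.mul_mem_right (monomial m₂ 1) _ this using 1
    ring
  rw [← Ideal.Quotient.eq_zero_iff_mem]
  simp only [map_mul]
  rcases a with a | a <;> rcases b with b | b
  · linear_combination hT' j i a b
  · linear_combination h.yyzz_of_yyyz hT' i a j b
  · linear_combination h.yyzz_of_yyyz hT' i b j a
  · linear_combination h.yzzz_of_yyyz hT' i j a b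

/-- A multilinear form of degree three which is not a multiple of `cubicForm` has all polynomials
of degree four as consequences. -/
theorem yyyz_mem_of_form {L : Ideal (Poly K d)} (hL : cubicIdeal K d ≤ L)
    {a₁ a₂ a₃ b₁ b₂ b₃ : K} (hne : ¬(a₁ = a₂ ∧ a₂ = a₃ ∧ b₁ = b₂ ∧ b₂ = b₃ ∧ a₁ = b₁))
    (H : ∀ g₁ g₂ g₃ : G K d,
      C a₁ * (g₁.toY * g₂.toY * g₃.toZ) + C a₂ * (g₁.toY * g₃.toY * g₂.toZ) +
        C a₃ * (g₂.toY * g₃.toY * g₁.toZ) + C b₁ * (g₁.toY * g₂.toZ * g₃.toZ) +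
        C b₂ * (g₂.toY * g₁.toZ * g₃.toZ) + C b₃ * (g₃.toY * g₁.toZ * g₂.toZ) ∈ L)
    (i j k l : Fin d) : y K j * y K k * y K l * z K i ∈ L := by
  have h := cubicRel hL
  set π := Ideal.Quotient.mk L with hπ
  have H' : ∀ g₁ g₂ g₃ : G K d, π (C a₁) * (π g₁.toY * π g₂.toY * π g₃.toZ) +
      π (C a₂) * (π g₁.toY * π g₃.toY * π g₂.toZ) + π (C a₃) * (π g₂.toY * π g₃.toY * π g₁.toZ) +
      π (C b₁) * (π g₁.toY * π g₂.toZ * π g₃.toZ) + π (C b₂) * (π g₂.toY * π g₁.toZ * π g₃.toZ) +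
      π (C b₃) * (π g₃.toY * π g₁.toZ * π g₂.toZ) = 0 := fun g₁ g₂ g₃ => by
    simp only [← map_mul, ← map_add]; exact Ideal.Quotient.eq_zero_iff_mem.2 (H g₁ g₂ g₃)
  suffices π (y K j) * π (y K k) * π (y K l) * π (z K i) = 0 by
    rw [← Ideal.Quotient.eq_zero_iff_mem]; simpa only [map_mul] using this
  -- the alternating case
  have alt : ∀ s t : K, (s ≠ 0 ∨ t ≠ 0) → (∀ g₁ g₂ g₃ : G K d,
      (π (C s) * π g₃.toY + π (C t) * π g₃.toZ) * (π g₁.toY * π g₂.toZ - π g₂.toY * π g₁.toZ) = 0) →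
      π (y K j) * π (y K k) * π (y K l) * π (z K i) = 0 := by
    intro s t hst h₃
    refine h.yyyz_of_alt (s := π (C s)) (t := π (C t)) ?_ (fun i j k => ?_) (fun i j k l => ?_)
      i j k l
    -- The scalars s + t and t - 2s cannot both vanish: that would give 3s = 0, hence s = t = 0.
    · by_cases hs : s + t = 0
      · refine Or.inr fun q hq => eq_zero_of_mk_C_mul (c := t - 2 * s) ?_ q ?_
        · intro h0
          have h3 : 3 * s = 0 := by linear_combination hs - h0
          have hs0 : s = 0 := by simpa using h3
          have ht0 : t = 0 := by linear_combination hs - hs0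
          exact hst.elim (fun h => h hs0) (fun h => h ht0)
        · rwa [map_sub, map_sub, map_mul, map_mul, map_ofNat C 2, map_ofNat]
      · exact Or.inl fun q hq => eq_zero_of_mk_C_mul hs q (by simpa using hq)
    · simpa only [toY_x, toZ_x] using h₃ (G.x i) (G.x j) (G.x k)
    · have := h₃ (G.x i) (G.x j) (ofPoly _ (y_mul_z_mem_sq k l))
      simp only [toY_x, toZ_x, toY_ofPoly, toZ_ofPoly, map_mul] at this
      linear_combination this
  -- If two of the `a`'s or two of the `b`'s differ, exchanging two arguments and subtracting leaves
  -- an alternating relation with these differences as coefficients. Otherwise the form is a₁ times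
  -- the yyz-sum plus b₁ times the yzz-sum, and subtracting b₁ times `rel₃` isolates the former.
  by_cases h1 : a₂ - a₃ = 0 ∧ b₁ - b₂ = 0
  · by_cases h2 : a₁ - a₂ = 0 ∧ b₂ - b₃ = 0
    · have e2 := sub_eq_zero.1 h1.1
      have e1 := sub_eq_zero.1 h2.1
      have e3 := sub_eq_zero.1 h1.2
      have e4 := sub_eq_zero.1 h2.2
      have hab : a₁ - b₁ ≠ 0 := fun h0 => hne ⟨e1, e2, e3, e4, sub_eq_zero.1 h0⟩
      refine h.yyyz_of_symm (fun i j k => ?_) i j k l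
      apply eq_zero_of_mk_C_mul hab
      have := H' (G.x i) (G.x j) (G.x k)
      rw [← e4, ← e3, ← e2, ← e1] at this
      simp only [toY_x, toZ_x] at this
      rw [C_sub, map_sub]
      linear_combination this - π (C b₁) * h.rel₃ i j k
    · refine alt (a₁ - a₂) (b₂ - b₃) (by tauto) fun g₂ g₃ g₁ => ?_
      simp only [map_sub]
      linear_combination H' g₁ g₂ g₃ - H' g₁ g₃ g₂
  · refine alt (a₂ - a₃) (b₁ - b₂) (by tauto) fun g₁ g₂ g₃ => ?_
    simp only [map_sub]
    linear_combination H' g₁ g₂ g₃ - H' g₂ g₁ g₃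

end

open MvPolynomial G

section

variable {K : Type*} [Field K] {d : ℕ}

/-! ### Polarization of polynomials of degree two and three -/

theorem exists_coeff_of_isHomogeneous_two {p : Poly K d} (hp : p ∈ sq K d)
    (hn : p.IsHomogeneous 2) :
    ∃ c : Fin d → Fin d → K, p = ∑ i, ∑ j, C (c i j) * (y K i * z K j) := by
  have h : p ∈ Submodule.span K (Set.range fun t : Fin d × Fin d => y K t.1 * z K t.2) := by
    refine mem_of_forall_monomial_mem _ hp hn fun i j m hm => ?_
    obtain rfl : m = 0 := (Finsupp.degree_eq_zero_iff m).1 (by omega)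
    refine Submodule.subset_span ⟨(i, j), ?_⟩
    simp
  obtain ⟨c, rfl⟩ := (Submodule.mem_span_range_iff_exists_fun K).1 h
  exact ⟨fun i j => c (i, j), by simp only [Fintype.sum_prod_type, smul_eq_C_mul]⟩

theorem exists_coeff_of_isHomogeneous_three {p : Poly K d} (hp : p ∈ sq K d)
    (hn : p.IsHomogeneous 3) :
    ∃ a b : Fin d → Fin d → Fin d → K, p = ∑ i, ∑ j, ∑ k,
      (C (a i j k) * (y K i * y K j * z K k) + C (b i j k) * (y K i * z K j * z K k)) := by
  have h : p ∈ Submodule.span K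
      (Set.range fun t : Fin d × Fin d × Fin d => y K t.1 * y K t.2.1 * z K t.2.2) ⊔
      Submodule.span K
      (Set.range fun t : Fin d × Fin d × Fin d => y K t.1 * z K t.2.1 * z K t.2.2) := by
    refine mem_of_forall_monomial_mem _ hp hn fun i j m hm => ?_
    obtain ⟨s, m', h', e⟩ := exists_monomial_eq_X_mul (K := K)
      (show Finsupp.degree m = 0 + 1 by omega)
    obtain rfl : m' = 0 := (Finsupp.degree_eq_zero_iff m').1 h'
    rw [e]
    rcases s with s | s
    · refine Submodule.mem_sup_left (Submodule.subset_span ⟨(i, s, j), ?_⟩)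
      simp only [← C_apply, C_1]; ring
    · refine Submodule.mem_sup_right (Submodule.subset_span ⟨(i, j, s), ?_⟩)
      simp only [← C_apply, C_1]; ring
  obtain ⟨_, hq, _, hr, rfl⟩ := Submodule.mem_sup.1 h
  obtain ⟨a, rfl⟩ := (Submodule.mem_span_range_iff_exists_fun K).1 hq
  obtain ⟨b, rfl⟩ := (Submodule.mem_span_range_iff_exists_fun K).1 hr
  refine ⟨fun i j k => a (i, j, k), fun i j k => b (i, j, k), ?_⟩
  simp only [Fintype.sum_prod_type, smul_eq_C_mul, Finset.sum_add_distrib]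

theorem polyMap_C (v : Fin d → G K d) (c : K) : polyMap v (C c) = C c := by
  simp [polyMap, algebraMap_eq]

theorem toY_single (i : Fin d) (g : G K d) (j : Fin d) :
    ((Pi.single i g : Fin d → G K d) j).toY = if j = i then g.toY else 0 := by
  rw [Pi.single_apply]; split_ifs <;> simp

theorem toZ_single (i : Fin d) (g : G K d) (j : Fin d) :
    ((Pi.single i g : Fin d → G K d) j).toZ = if j = i then g.toZ else 0 := by
  rw [Pi.single_apply]; split_ifs <;> simp

/-- The substitution supported on i and j kills the other generators, and removing the two pure
terms leaves the mixed part. The case i = j is covered, because the two values then add up. -/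
theorem polarization_two_mem {L : Ideal (Poly K d)} (hL : ∀ v, ∀ p ∈ L, polyMap v p ∈ L)
    (c : Fin d → Fin d → K) (h : ∑ i, ∑ j, C (c i j) * (y K i * z K j) ∈ L) (i j : Fin d)
    (g₁ g₂ : G K d) : C (c i j) * (g₁.toY * g₂.toZ) + C (c j i) * (g₂.toY * g₁.toZ) ∈ L := by
  have e : C (c i j) * (g₁.toY * g₂.toZ) + C (c j i) * (g₂.toY * g₁.toZ) =
      polyMap (Pi.single i g₁ + Pi.single j g₂) (∑ i, ∑ j, C (c i j) * (y K i * z K j)) -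
      polyMap (Pi.single i g₁) (∑ i, ∑ j, C (c i j) * (y K i * z K j)) -
      polyMap (Pi.single j g₂) (∑ i, ∑ j, C (c i j) * (y K i * z K j)) := by
    simp only [map_sum, map_mul, polyMap_C, polyMap_y, polyMap_z, Pi.add_apply, map_add,
      toY_single, toZ_single, mul_add, add_mul, Finset.sum_add_distrib, mul_ite, ite_mul,
      mul_zero, zero_mul, Finset.sum_ite_eq', Finset.mem_univ, if_true]
    ring
  rw [e]
  exact sub_mem (sub_mem (hL _ _ h) (hL _ _ h)) (hL _ _ h)

theorem polarization_three_mem {L : Ideal (Poly K d)} (hL : ∀ v, ∀ p ∈ L, polyMap v p ∈ L)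
    (a b : Fin d → Fin d → Fin d → K) (h : ∑ i, ∑ j, ∑ k,
      (C (a i j k) * (y K i * y K j * z K k) + C (b i j k) * (y K i * z K j * z K k)) ∈ L)
    (i j k : Fin d) (g₁ g₂ g₃ : G K d) :
    C (a i j k + a j i k) * (g₁.toY * g₂.toY * g₃.toZ) +
      C (a i k j + a k i j) * (g₁.toY * g₃.toY * g₂.toZ) +
      C (a j k i + a k j i) * (g₂.toY * g₃.toY * g₁.toZ) +
      C (b i j k + b i k j) * (g₁.toY * g₂.toZ * g₃.toZ) +
      C (b j i k + b j k i) * (g₂.toY * g₁.toZ * g₃.toZ) +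
      C (b k i j + b k j i) * (g₃.toY * g₁.toZ * g₂.toZ) ∈ L := by
  set p := ∑ i, ∑ j, ∑ k,
    (C (a i j k) * (y K i * y K j * z K k) + C (b i j k) * (y K i * z K j * z K k)) with hp
  set v₁ : Fin d → G K d := Pi.single i g₁ with h₁
  set v₂ : Fin d → G K d := Pi.single j g₂ with h₂
  set v₃ : Fin d → G K d := Pi.single k g₃ with h₃
  -- `T` gives each of the three slots its own substitution; its symmetrization over v₁, v₂, v₃ is
  -- the inclusion–exclusion combination of values of `polyMap` at p.
  let T : (Fin d → G K d) → (Fin d → G K d) → (Fin d → G K d) → Poly K d := fun u v w =>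
    ∑ i, ∑ j, ∑ k, (C (a i j k) * ((u i).toY * (v j).toY * (w k).toZ) +
      C (b i j k) * ((u i).toY * (v j).toZ * (w k).toZ))
  have hT : ∀ v, polyMap v p = T v v v := fun v => by
    simp only [hp, T, map_sum, map_add, map_mul, polyMap_C, polyMap_y, polyMap_z]
  have e : T v₁ v₂ v₃ + T v₁ v₃ v₂ + T v₂ v₁ v₃ + T v₂ v₃ v₁ + T v₃ v₁ v₂ + T v₃ v₂ v₁ =
      polyMap (v₁ + v₂ + v₃) p - polyMap (v₁ + v₂) p - polyMap (v₁ + v₃) p - polyMap (v₂ + v₃) p +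
        polyMap v₁ p + polyMap v₂ p + polyMap v₃ p := by
    simp only [hT, T, ← Finset.sum_add_distrib, ← Finset.sum_sub_distrib]
    refine Finset.sum_congr rfl fun i _ => Finset.sum_congr rfl fun j _ =>
      Finset.sum_congr rfl fun k _ => ?_
    simp only [Pi.add_apply, map_add]
    ring
  have hs : ∀ (i j k : Fin d) (g₁ g₂ g₃ : G K d),
      T (Pi.single i g₁) (Pi.single j g₂) (Pi.single k g₃) =
        C (a i j k) * (g₁.toY * g₂.toY * g₃.toZ) + C (b i j k) * (g₁.toY * g₂.toZ * g₃.toZ) := by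
    intro i j k g₁ g₂ g₃
    simp only [T, toY_single, toZ_single, Finset.sum_add_distrib, mul_ite, ite_mul,
      mul_zero, zero_mul, Finset.sum_ite_eq', Finset.mem_univ, if_true]
  have h7 : T v₁ v₂ v₃ + T v₁ v₃ v₂ + T v₂ v₁ v₃ + T v₂ v₃ v₁ + T v₃ v₁ v₂ + T v₃ v₂ v₁ ∈ L := by
    rw [e]
    have h := fun v => hL v _ h
    exact add_mem (add_mem (add_mem (sub_mem (sub_mem (sub_mem (h _) (h _)) (h _)) (h _)) (h _))
      (h _)) (h _)
  rw [h₁, h₂, h₃] at h7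
  simp only [hs] at h7
  convert h7 using 1
  simp only [C_add]
  ring

variable [CharZero K]

/-- The form is recovered from its polarization: after renaming indices, summing the common
coefficient times `cubicForm` at generators gives three equal sums of each type yyz and yzz, each
doubled by the symmetrization. This is the factor 6. -/
theorem mem_cubicIdeal_of_symm (a b : Fin d → Fin d → Fin d → K)
    (h : ∀ i j k, a i j k + a j i k = a i k j + a k i j ∧ a i k j + a k i j = a j k i + a k j i ∧
      b i j k + b i k j = b j i k + b j k i ∧ b j i k + b j k i = b k i j + b k j i ∧
      a i j k + a j i k = b i j k + b i k j) :
    ∑ i, ∑ j, ∑ k, (C (a i j k) * (y K i * y K j * z K k) + C (b i j k) * (y K i * z K j * z K k))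
      ∈ cubicIdeal K d := by
  refine mem_of_C_mul_mem (show (6 : K) ≠ 0 by norm_num) ?_
  have r₁ : ∀ f : Fin d → Fin d → Fin d → Poly K d,
      ∑ i, ∑ j, ∑ k, f i j k = ∑ i, ∑ j, ∑ k, f j i k := fun f => Finset.sum_comm
  have r₂ : ∀ f : Fin d → Fin d → Fin d → Poly K d,
      ∑ i, ∑ j, ∑ k, f i j k = ∑ i, ∑ j, ∑ k, f i k j := fun f =>
    Finset.sum_congr rfl fun _ _ => Finset.sum_comm
  have e : C 6 * ∑ i, ∑ j, ∑ k,
      (C (a i j k) * (y K i * y K j * z K k) + C (b i j k) * (y K i * z K j * z K k)) =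
      ∑ i, ∑ j, ∑ k, C (a i j k + a j i k) * cubicForm (G.x i) (G.x j) (G.x k) := by
    let u : Fin d → Fin d → Fin d → Poly K d := fun i j k => y K i * y K j * z K k
    let v : Fin d → Fin d → Fin d → Poly K d := fun i j k => y K i * z K j * z K k
    have e₁ : ∑ i, ∑ j, ∑ k, C (a i j k + a j i k) * cubicForm (G.x i) (G.x j) (G.x k) =
        ∑ i, ∑ j, ∑ k, (C (a i j k + a j i k) * u i j k) +
        ∑ i, ∑ j, ∑ k, (C (a i k j + a k i j) * u i k j) +
        ∑ i, ∑ j, ∑ k, (C (a j k i + a k j i) * u j k i) +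
        ∑ i, ∑ j, ∑ k, (C (b i j k + b i k j) * v i j k) +
        ∑ i, ∑ j, ∑ k, (C (b j i k + b j k i) * v j i k) +
        ∑ i, ∑ j, ∑ k, (C (b k i j + b k j i) * v k i j) := by
      simp only [← Finset.sum_add_distrib]
      refine Finset.sum_congr rfl fun i _ => Finset.sum_congr rfl fun j _ =>
        Finset.sum_congr rfl fun k _ => ?_
      obtain ⟨h1, h2, h3, h4, h5⟩ := h i j k
      rw [← h4, ← h3, ← h2, ← h1, ← h5]
      simp only [cubicForm, toY_x, toZ_x, u, v]
      ring
    have s₂ : ∑ i, ∑ j, ∑ k, (C (a i k j + a k i j) * u i k j) =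
        ∑ i, ∑ j, ∑ k, (C (a i j k + a j i k) * u i j k) :=
      r₂ fun i j k => C (a i k j + a k i j) * u i k j
    have s₃ : ∑ i, ∑ j, ∑ k, (C (a j k i + a k j i) * u j k i) =
        ∑ i, ∑ j, ∑ k, (C (a i j k + a j i k) * u i j k) :=
      (r₁ fun i j k => C (a j k i + a k j i) * u j k i).trans
        (r₂ fun i j k => C (a i k j + a k i j) * u i k j)
    have s₅ : ∑ i, ∑ j, ∑ k, (C (b j i k + b j k i) * v j i k) =
        ∑ i, ∑ j, ∑ k, (C (b i j k + b i k j) * v i j k) :=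
      r₁ fun i j k => C (b j i k + b j k i) * v j i k
    have s₆ : ∑ i, ∑ j, ∑ k, (C (b k i j + b k j i) * v k i j) =
        ∑ i, ∑ j, ∑ k, (C (b i j k + b i k j) * v i j k) :=
      (r₂ fun i j k => C (b k i j + b k j i) * v k i j).trans
        (r₁ fun i j k => C (b j i k + b j k i) * v j i k)
    have t₁ : ∑ i, ∑ j, ∑ k, (C (a i j k + a j i k) * u i j k) =
        2 * ∑ i, ∑ j, ∑ k, C (a i j k) * u i j k := by
      simp only [C_add, add_mul, Finset.sum_add_distrib, two_mul]
      refine congrArg _ ((r₁ fun i j k => C (a j i k) * u i j k).trans ?_)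
      refine Finset.sum_congr rfl fun i _ => Finset.sum_congr rfl fun j _ =>
        Finset.sum_congr rfl fun k _ => ?_
      rw [show u j i k = u i j k by simp only [u]; ring]
    have t₂ : ∑ i, ∑ j, ∑ k, (C (b i j k + b i k j) * v i j k) =
        2 * ∑ i, ∑ j, ∑ k, C (b i j k) * v i j k := by
      simp only [C_add, add_mul, Finset.sum_add_distrib, two_mul]
      refine congrArg _ ((r₂ fun i j k => C (b i k j) * v i j k).trans ?_)
      refine Finset.sum_congr rfl fun i _ => Finset.sum_congr rfl fun j _ =>
        Finset.sum_congr rfl fun k _ => ?_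
      rw [show v i k j = v i j k by simp only [v]; ring]
    rw [e₁, s₂, s₃, s₅, s₆, t₁, t₂, map_ofNat C 6]
    simp only [Finset.sum_add_distrib, u, v]
    ring
  rw [e]
  exact sum_mem fun i _ => sum_mem fun j _ => sum_mem fun k _ =>
    Ideal.mul_mem_left _ _ (cubicForm_mem _ _ _)

/-! ### Consequences of elements of degree three and two -/

/-- Outside `cubicIdeal`, some triple of indices has a polarization that is not a multiple of
`cubicForm`, by `mem_cubicIdeal_of_symm`. -/
theorem mem_of_isHomogeneous_three_mem {L : Ideal (Poly K d)} (hJ : cubicIdeal K d ≤ L)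
    (hL : ∀ v, ∀ p ∈ L, polyMap v p ∈ L) {p : Poly K d} (hp : p ∈ sq K d)
    (hn : p.IsHomogeneous 3) (hpL : p ∈ L) (hpJ : p ∉ cubicIdeal K d) {q : Poly K d}
    (hq : q ∈ sq K d) (hqn : q.IsHomogeneous 4) : q ∈ L := by
  obtain ⟨a, b, rfl⟩ := exists_coeff_of_isHomogeneous_three hp hn
  have h : ∃ i j k, ¬(a i j k + a j i k = a i k j + a k i j ∧
      a i k j + a k i j = a j k i + a k j i ∧ b i j k + b i k j = b j i k + b j k i ∧
      b j i k + b j k i = b k i j + b k j i ∧ a i j k + a j i k = b i j k + b i k j) := by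
    by_contra! hc
    exact hpJ (mem_cubicIdeal_of_symm a b hc)
  obtain ⟨i, j, k, hne⟩ := h
  exact mem_of_isHomogeneous_four hJ
    (yyyz_mem_of_form hJ hne (polarization_three_mem hL a b hpL i j k)) hq hqn

theorem mem_of_isHomogeneous_two_mem {L : Ideal (Poly K d)} (hJ : cubicIdeal K d ≤ L)
    (hL : ∀ v, ∀ p ∈ L, polyMap v p ∈ L) {p : Poly K d} (hp : p ∈ sq K d)
    (hn : p.IsHomogeneous 2) (hpL : p ∈ L) (hp0 : p ≠ 0) {q : Poly K d}
    (hq : q ∈ sq K d) (hqn : q.IsHomogeneous 3) : q ∈ L := by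
  obtain ⟨c, rfl⟩ := exists_coeff_of_isHomogeneous_two hp hn
  have h : ∃ i j, c i j ≠ 0 := by
    by_contra! hc
    exact hp0 (by simp [hc])
  obtain ⟨r, s, hne⟩ := h
  have hR := cubicRel hJ
  set π := Ideal.Quotient.mk L with hπ
  have H : ∀ g₁ g₂ : G K d, π (C (c r s)) * (π g₁.toY * π g₂.toZ) +
      π (C (c s r)) * (π g₂.toY * π g₁.toZ) = 0 := fun g₁ g₂ => by
    simp only [← map_mul, ← map_add]
    exact Ideal.Quotient.eq_zero_iff_mem.2 (polarization_two_mem hL c hpL r s g₁ g₂)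
  have key : (∀ i j k, π (y K i) * π (y K j) * π (z K k) = 0) ∧
      ∀ i j k, π (y K i) * π (z K j) * π (z K k) = 0 := by
    -- If the sum is zero, the polarization is alternating; a quadratic argument then identifies yyz
    -- with yzz, all six terms of `rel₃` coincide and 6 is cancelled. Otherwise y_i z_j is skew in
    -- i, j, so y_i y_j z_k is symmetric in one pair of indices and skew in another, hence zero.
    by_cases hs : c r s + c s r = 0
    · have H' : ∀ g₁ g₂ : G K d, π g₁.toY * π g₂.toZ - π g₂.toY * π g₁.toZ = 0 := fun g₁ g₂ => by
        apply eq_zero_of_mk_C_mul hne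
        have h0 : π (C (c r s)) + π (C (c s r)) = 0 := by
          rw [← map_add, ← C_add, hs, C_0, map_zero]
        linear_combination H g₁ g₂ - (π g₂.toY * π g₁.toZ) * h0
      have s₁ : ∀ i j, π (y K i) * π (z K j) - π (y K j) * π (z K i) = 0 := fun i j => by
        simpa only [toY_x, toZ_x] using H' (G.x i) (G.x j)
      have s₂ : ∀ i j k, π (y K k) * (π (y K i) * π (z K j)) -
          π (y K i) * π (z K j) * π (z K k) = 0 := fun i j k => by
        simpa only [toY_x, toZ_x, toY_ofPoly, toZ_ofPoly, map_mul] using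
          H' (G.x k) (ofPoly _ (y_mul_z_mem_sq i j))
      have hy : ∀ i j k, π (y K i) * π (y K j) * π (z K k) = 0 := fun i j k => by
        apply hR.three_mul_eq_zero
        apply hR.two_mul_eq_zero
        linear_combination hR.rel₃ i j k + 2 * π (y K i) * s₁ j k + 3 * π (y K j) * s₁ i k +
          s₂ i j k + s₂ j i k + s₂ k i j
      exact ⟨hy, fun i j k => by linear_combination hy i k j - s₂ i j k⟩
    · have H' : ∀ i j, π (y K i) * π (z K j) + π (y K j) * π (z K i) = 0 := fun i j => by
        apply eq_zero_of_mk_C_mul hs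
        have h1 := H (G.x i) (G.x j)
        have h2 := H (G.x j) (G.x i)
        simp only [toY_x, toZ_x] at h1 h2
        rw [C_add, map_add]
        linear_combination h1 + h2
      refine ⟨fun i j k => ?_, fun i j k => ?_⟩
      · apply hR.two_mul_eq_zero
        linear_combination π (y K i) * H' j k + π (y K j) * H' i k - π (y K k) * H' i j
      · apply hR.two_mul_eq_zero
        linear_combination π (z K k) * H' i j + π (z K j) * H' i k - π (z K i) * H' j k
  refine mem_of_forall_monomial_mem (L.restrictScalars K) hq hqn fun i j m hm => ?_
  obtain ⟨a, m₁, h₁, e₁⟩ := exists_monomial_eq_X_mul (K := K)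
    (show Finsupp.degree m = 0 + 1 by omega)
  rw [e₁, Submodule.restrictScalars_mem]
  suffices y K i * z K j * X a ∈ L by
    convert Ideal.mul_mem_right (monomial m₁ 1) _ this using 1
    ring
  rw [← Ideal.Quotient.eq_zero_iff_mem]
  simp only [map_mul]
  rcases a with a | a
  · linear_combination key.1 i a j
  · exact key.2 i j a

end

open MvPolynomial G

section

variable {K : Type*} [Field K] {d : ℕ}

/-! ### Homogeneous components -/

variable (K d) in
/-- The endomorphism `x_i ↦ 2 x_i` of `G_d`. -/
noncomputable def double : G K d →ₙₐ[K] G K d := subst fun i => (2 : K) • G.x i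

theorem polyMap_two_smul {p : Poly K d} {n : ℕ} (hn : p.IsHomogeneous n) :
    polyMap (fun i => (2 : K) • G.x i) p = (2 : K) ^ n • p := by
  have e : polyMap (fun i => (2 : K) • G.x i) = aeval fun s : Fin d ⊕ Fin d => C (2 : K) * X s := by
    rw [polyMap]
    congr 1
    funext s
    rcases s with s | s <;> simp [toY_x, toZ_x, smul_eq_C_mul]
  rw [e]
  conv_lhs => rw [p.as_sum]
  conv_rhs => rw [p.as_sum]
  rw [map_sum, Finset.smul_sum]
  refine Finset.sum_congr rfl fun m hm => ?_
  have hd := degree_eq_of_isHomogeneous hn (mem_support_iff.1 hm)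
  rw [aeval_monomial, monomial_eq, smul_eq_C_mul, Finsupp.prod, Finsupp.prod]
  simp only [mul_pow, Finset.prod_mul_distrib, Finset.prod_pow_eq_pow_sum, algebraMap_eq]
  rw [show ∑ i ∈ m.support, m i = n from hd, C_pow]
  ring

theorem double_of_mem_homG {a : G K d} {n : ℕ} (ha : a ∈ homG K d n) :
    double K d a = (2 : K) ^ n • a := by
  ext1
  · rw [double, subst_apply, lin_add, lin_ofPoly, add_zero, lin_sum, lin_smul]
    by_cases hn : n = 1
    · funext j
      simp [hn, lin_smul, lin_x, Pi.single_apply, mul_comm]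
    · simp only [ha.1 hn, Pi.zero_apply, zero_smul, lin_zero, smul_zero, Finset.sum_const_zero]
  · rw [poly_smul, ← polyMap_two_smul ha.2, double, subst_apply, poly_add, poly_sum, poly_ofPoly]
    simp [poly_smul, poly_x]

theorem double_of_mem_homGU (α₁ α₂ : K) (n : ℕ) {u : GU K d α₁ α₂}
    (hu : u ∈ homGU K d α₁ α₂ n) : factorMap _ (double K d) u = (2 : K) ^ n • u := by
  obtain ⟨a, ha, rfl⟩ := hu
  exact (congrArg (toGU K d α₁ α₂) (double_of_mem_homG ha)).trans (map_smul _ _ _)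

theorem double_mem_iSup (α₁ α₂ : K) (n : ℕ) {g : GU K d α₁ α₂}
    (hg : g ∈ ⨆ k < n, homGU K d α₁ α₂ k) :
    factorMap _ (double K d) g ∈ ⨆ k < n, homGU K d α₁ α₂ k := by
  have h : (⨆ k < n, homGU K d α₁ α₂ k) ≤ (⨆ k < n, homGU K d α₁ α₂ k).comap
      (factorMap (identityU K d α₁ α₂) (double K d) : GU K d α₁ α₂ →ₗ[K] GU K d α₁ α₂) := by
    refine iSup₂_le fun k hk u hu => ?_
    have hk' : homGU K d α₁ α₂ k ≤ ⨆ k < n, homGU K d α₁ α₂ k :=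
      le_iSup₂_of_le k hk le_rfl
    rw [Submodule.mem_comap]
    change factorMap _ (double K d) u ∈ _
    rw [double_of_mem_homGU _ _ _ hu]
    exact Submodule.smul_mem _ _ (hk' hu)
  exact h hg

/-- Separation of eigenvectors of the doubling map D: (D - 2^n)/(c - 2^n) preserves N, fixes u and
kills the component of degree n of the remainder, which lowers the bound on degrees. -/
theorem mem_of_add_mem (α₁ α₂ : K) {N : Submodule K (GU K d α₁ α₂)} (hN : IsTIdeal K N) {c : K} :
    ∀ (n : ℕ) (u g : GU K d α₁ α₂), factorMap _ (double K d) u = c • u → (∀ k < n, c ≠ 2 ^ k) →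
      g ∈ ⨆ k < n, homGU K d α₁ α₂ k → u + g ∈ N → u ∈ N
  | 0, u, g, _, _, hg, h => by
    have : g = 0 := by simpa using hg
    rwa [this, add_zero] at h
  | n + 1, u, g, hu, hc, hg, h => by
    rw [Nat.iSup_lt_succ, Submodule.mem_sup] at hg
    obtain ⟨g', hg', v, hv, rfl⟩ := hg
    have hcn : c - 2 ^ n ≠ 0 := sub_ne_zero.2 (hc n n.lt_succ_self)
    refine mem_of_add_mem α₁ α₂ hN n u
      ((c - 2 ^ n)⁻¹ • (factorMap _ (double K d) g' - (2 : K) ^ n • g')) hu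
      (fun k hk => hc k (hk.trans n.lt_succ_self))
      (Submodule.smul_mem _ _ (sub_mem (double_mem_iSup _ _ _ hg') (Submodule.smul_mem _ _ hg'))) ?_
    have h1 := N.smul_mem (c - 2 ^ n)⁻¹ (sub_mem (hN.map_mem (factorMap _ (double K d)) _ h)
      (N.smul_mem ((2 : K) ^ n) h))
    convert h1 using 1
    rw [map_add, map_add, hu, double_of_mem_homGU _ _ _ hv]
    have e : u = (c - 2 ^ n)⁻¹ • (c - 2 ^ n) • u := (inv_smul_smul₀ hcn u).symm
    conv_lhs => rw [e]
    rw [← smul_add]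
    congr 1
    module

theorem exists_leading [CharZero K] {α : K} {f : GU K d α α} {n : ℕ} (hf : HasDegree f n) :
    ∃ a ∈ homG K d n, a ∉ tIdeal K (identityU K d α α) ∧ toGU K d α α a ∈ tIdeal K {f} := by
  obtain ⟨_, ⟨a, ha, rfl⟩, hu, hg⟩ := hf
  refine ⟨a, ha, fun h => hu ((Submodule.Quotient.mk_eq_zero _).2 h), ?_⟩
  refine mem_of_add_mem α α (isTIdeal_tIdeal K {f}) n _ _
    (double_of_mem_homGU _ _ n ⟨a, ha, rfl⟩) (fun k hk h => ?_) hg ?_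
  · have h2 : (2 : ℕ) ^ n = 2 ^ k := by exact_mod_cast h
    exact hk.ne' (Nat.pow_right_injective le_rfl h2)
  · rw [add_sub_cancel]
    exact mem_tIdeal_self rfl

theorem homGU_succ_le_tIdeal [CharZero K] {α : K} (hα : α ≠ 0) {n : ℕ} (hn : n ∈ ({1, 2, 3} : Set ℕ))
    {f : GU K d α α} (hf : HasDegree f n) : homGU K d α α (n + 1) ≤ tIdeal K {f} := by
  obtain ⟨a, ha, haI, haf⟩ := exists_leading hf
  have hN : IsTIdeal K ((tIdeal K {f}).comap (toGU K d α α)) := (isTIdeal_tIdeal K {f}).comap_mkQ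
  have hJ : cubicIdeal K d ≤ polyIdeal hN := cubicIdeal_le_polyIdeal hα hN fun b hb => by
    have h0 : toGU K d α α b = 0 := (Submodule.Quotient.mk_eq_zero _).2 (mem_tIdeal_self hb)
    change toGU K d α α b ∈ tIdeal K {f}
    rw [h0]
    exact zero_mem _
  have hL := fun v p hp => polyMap_mem_polyIdeal hN v (u := p) hp
  rw [mem_tIdeal_identityU hα] at haI
  suffices h : ∀ b ∈ homG K d (n + 1), b.poly ∈ polyIdeal hN by
    rintro _ ⟨b, hb, rfl⟩
    exact mem_of_poly_mem hN (hb.1 (by rcases hn with rfl | rfl | rfl <;> norm_num)) (h b hb)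
  intro b hb
  rcases hn with rfl | rfl | rfl
  -- `sq` has nothing in degree one, so the element is linear.
  · have hap : a.poly = 0 := by
      have := mem_of_forall_monomial_mem ⊥ a.poly_mem ha.2 fun i j m hm => by omega
      simpa using this
    have hal : a.lin ≠ 0 := fun h => haI ⟨h, by rw [hap]; exact zero_mem _⟩
    obtain ⟨i, hi⟩ := Function.ne_iff.1 hal
    -- Sending x_i to x_j and the other generators to zero turns the element into a nonzero multiple
    -- of x_j.
    have hx : ∀ j, G.x j ∈ (tIdeal K {f}).comap (toGU K d α α) := fun j => by
      have h1 := hN.map_mem (subst (Pi.single i (G.x j))) a haf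
      have h2 : subst (Pi.single i (G.x j)) a = a.lin i • G.x j := by
        rw [subst_apply, Finset.sum_eq_single i]
        · ext1 <;> simp [hap, lin_add, poly_add, lin_ofPoly, poly_ofPoly]
        · intro k _ hk
          rw [Pi.single_eq_of_ne hk, smul_zero]
        · simp
      rw [h2] at h1
      simpa [inv_smul_smul₀ hi] using Submodule.smul_mem _ (a.lin i)⁻¹ h1
    refine sq_le_of_forall (fun k l => ?_) b.poly_mem
    have := poly_mem_polyIdeal hN (lin_mul (G.x k) (G.x l)) (hN.mul_left_mem _ _ (hx l))
    rwa [poly_mul, toY_x, toZ_x] at this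
  · have hal := ha.1 (by norm_num)
    refine mem_of_isHomogeneous_two_mem hJ hL a.poly_mem ha.2 (poly_mem_polyIdeal hN hal haf) ?_
      b.poly_mem hb.2
    intro h0
    exact haI ⟨hal, by rw [h0]; exact zero_mem _⟩
  · have hal := ha.1 (by norm_num)
    exact mem_of_isHomogeneous_three_mem hJ hL a.poly_mem ha.2 (poly_mem_polyIdeal hN hal haf)
      (fun h => haI ⟨hal, h⟩) b.poly_mem hb.2

theorem homGU_eq_bot [CharZero K] {α : K} (hα : α ≠ 0) {n : ℕ} (hn : 5 ≤ n) : homGU K d α α n = ⊥ := by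
  rw [eq_bot_iff]
  rintro _ ⟨a, ha, rfl⟩
  exact (Submodule.Quotient.mk_eq_zero _).2 ((mem_tIdeal_identityU hα).2
    ⟨ha.1 (by omega), mem_cubicIdeal_of_isHomogeneous hn a.poly_mem ha.2⟩)

theorem degree_eq_of_multilinear {n : ℕ} {m : Fin n ⊕ Fin n →₀ ℕ}
    (h : ∀ i, m (Sum.inl i) + m (Sum.inr i) = 1) : m.degree = n := by
  rw [Finsupp.degree_eq_sum, Fintype.sum_sum_type, ← Finset.sum_add_distrib]
  simp [h]

theorem multilinG_le_homG (n : ℕ) : multilinG K n ≤ homG K n n := fun a ha =>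
  ⟨ha.1, fun m hm => by
    have h := degree_eq_of_multilinear (ha.2 m hm)
    rw [Finsupp.degree_eq_weight_one] at h
    exact h⟩

theorem cocharacter_eq_zero [CharZero K] {α : K} (hα : α ≠ 0) {n : ℕ} (hn : 5 ≤ n) :
    cocharacter K α α n = 0 := by
  have h : multilinGU K α α n = ⊥ := by
    rw [eq_bot_iff, ← homGU_eq_bot hα hn]
    exact Submodule.map_mono (multilinG_le_homG n)
  have : Subsingleton (multilinGU K α α n) := by
    rw [h]; infer_instance
  funext σ
  rw [cocharacter, Subsingleton.elim (LinearMap.restrict _ _) 0, map_zero]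
  rfl

end

open MvPolynomial G

section

variable {K : Type*} [Field K] {d : ℕ}

/-! ### A functional on the component of degree four -/

/-- The degree of a monomial in `y_1, …, y_d`. -/
def degY (m : Fin d ⊕ Fin d →₀ ℕ) : ℕ := ∑ i, m (Sum.inl i)

/-- The degree of a monomial in `z_1, …, z_d`. -/
def degZ (m : Fin d ⊕ Fin d →₀ ℕ) : ℕ := ∑ i, m (Sum.inr i)

theorem degY_add (m m' : Fin d ⊕ Fin d →₀ ℕ) : degY (m + m') = degY m + degY m' := by
  simp [degY, Finset.sum_add_distrib]

theorem degZ_add (m m' : Fin d ⊕ Fin d →₀ ℕ) : degZ (m + m') = degZ m + degZ m' := by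
  simp [degZ, Finset.sum_add_distrib]

theorem degY_single_inl (i : Fin d) (n : ℕ) : degY (Finsupp.single (Sum.inl i) n) = n := by
  simp [degY, Finsupp.single_apply]

theorem degY_single_inr (i : Fin d) (n : ℕ) : degY (Finsupp.single (Sum.inr i) n) = 0 := by
  simp [degY]

theorem degZ_single_inl (i : Fin d) (n : ℕ) : degZ (Finsupp.single (Sum.inl i) n) = 0 := by
  simp [degZ]

theorem degZ_single_inr (i : Fin d) (n : ℕ) : degZ (Finsupp.single (Sum.inr i) n) = n := by
  simp [degZ, Finsupp.single_apply]

/-- The weight of an index which occurs `c` times among the `a` factors `y` and `e` times among the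
`b` factors `z` of a monomial. -/
def wt (a b : ℕ) (c e : K) : K :=
  -- Once T_i is sent to 4X_i minus the sum of all X_j, the relations 2 y_i y_j z_k z_l = T_i + T_j
  -- and yzzz = -yyyz force the other two formulas on multilinear monomials.
  if a = 3 ∧ b = 1 then 3 * e - c else if a = 2 ∧ b = 2 then c - e else
    if a = 1 ∧ b = 3 then e - 3 * c else 0

theorem wt_of_ne {a b : ℕ} (h : a + b ≠ 4) (c e : K) : wt a b c e = 0 := by
  rw [wt, if_neg (by omega), if_neg (by omega), if_neg (by omega)]

/-- The weights of the two monomials `toY g`, `toZ g`, where `g` is a monomial of `G_d`. -/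
def IsPairing (a b a' b' : ℕ) (c e c' e' : K) : Prop :=
  (a = 1 ∧ b = 0 ∧ a' = 0 ∧ b' = 1 ∧ e = 0 ∧ c' = 0 ∧ c = e') ∨
    (a = a' ∧ b = b' ∧ c = c' ∧ e = e' ∧ 1 ≤ a' ∧ 1 ≤ b')

/-- One index is followed at a time: a, b, c, e describe a monomial multiplier, the other data the
three arguments. Only total degree four matters, which leaves three generators and a variable, or
two generators and a quadratic monomial. The hypotheses `hc` and `he` say that an index does not
occur among zero factors. -/
theorem wt_cubicForm {a b : ℕ} {c e : K} (hc : a = 0 → c = 0) (he : b = 0 → e = 0)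
    {a₁ b₁ a₁' b₁' : ℕ} {c₁ e₁ c₁' e₁' : K} (h₁ : IsPairing a₁ b₁ a₁' b₁' c₁ e₁ c₁' e₁')
    {a₂ b₂ a₂' b₂' : ℕ} {c₂ e₂ c₂' e₂' : K} (h₂ : IsPairing a₂ b₂ a₂' b₂' c₂ e₂ c₂' e₂')
    {a₃ b₃ a₃' b₃' : ℕ} {c₃ e₃ c₃' e₃' : K} (h₃ : IsPairing a₃ b₃ a₃' b₃' c₃ e₃ c₃' e₃') :
    wt (a + (a₁ + a₂ + a₃')) (b + (b₁ + b₂ + b₃')) (c + (c₁ + c₂ + c₃')) (e + (e₁ + e₂ + e₃')) +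
    wt (a + (a₁ + a₃ + a₂')) (b + (b₁ + b₃ + b₂')) (c + (c₁ + c₃ + c₂')) (e + (e₁ + e₃ + e₂')) +
    wt (a + (a₂ + a₃ + a₁')) (b + (b₂ + b₃ + b₁')) (c + (c₂ + c₃ + c₁')) (e + (e₂ + e₃ + e₁')) +
    wt (a + (a₁ + a₂' + a₃')) (b + (b₁ + b₂' + b₃')) (c + (c₁ + c₂' + c₃'))
      (e + (e₁ + e₂' + e₃')) +
    wt (a + (a₂ + a₁' + a₃')) (b + (b₂ + b₁' + b₃')) (c + (c₂ + c₁' + c₃'))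
      (e + (e₂ + e₁' + e₃')) +
    wt (a + (a₃ + a₁' + a₂')) (b + (b₃ + b₁' + b₂')) (c + (c₃ + c₁' + c₂'))
      (e + (e₃ + e₁' + e₂')) = 0 := by
  by_cases hd : a + b + a₁ + b₁ + a₂ + b₂ + a₃ + b₃ = 4
  · rcases h₁ with ⟨rfl, rfl, rfl, rfl, rfl, rfl, rfl⟩ | ⟨rfl, rfl, rfl, rfl, h1, h1'⟩ <;>
    rcases h₂ with ⟨rfl, rfl, rfl, rfl, rfl, rfl, rfl⟩ | ⟨rfl, rfl, rfl, rfl, h2, h2'⟩ <;>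
    rcases h₃ with ⟨rfl, rfl, rfl, rfl, rfl, rfl, rfl⟩ | ⟨rfl, rfl, rfl, rfl, h3, h3'⟩ <;>
    try omega
    · obtain ⟨rfl, rfl⟩ | ⟨rfl, rfl⟩ : a = 1 ∧ b = 0 ∨ a = 0 ∧ b = 1 := by omega
      · obtain rfl := he rfl
        simp [wt]; ring
      · obtain rfl := hc rfl
        simp [wt]; ring
    · obtain ⟨rfl, rfl, rfl, rfl⟩ : a = 0 ∧ b = 0 ∧ a₃ = 1 ∧ b₃ = 1 := by omega
      simp [wt]; ring
    · obtain ⟨rfl, rfl, rfl, rfl⟩ : a = 0 ∧ b = 0 ∧ a₂ = 1 ∧ b₂ = 1 := by omega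
      simp [wt]; ring
    · obtain ⟨rfl, rfl, rfl, rfl⟩ : a = 0 ∧ b = 0 ∧ a₁ = 1 ∧ b₁ = 1 := by omega
      simp [wt]; ring
  · have t₁ : a₁ + b₁ = a₁' + b₁' := by rcases h₁ with h | h <;> omega
    have t₂ : a₂ + b₂ = a₂' + b₂' := by rcases h₂ with h | h <;> omega
    have t₃ : a₃ + b₃ = a₃' + b₃' := by rcases h₃ with h | h <;> omega
    rw [wt_of_ne (by omega), wt_of_ne (by omega), wt_of_ne (by omega), wt_of_ne (by omega),
      wt_of_ne (by omega), wt_of_ne (by omega)]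
    simp

/-- The linear map which sends a monomial to the vector of the weights of the indices. -/
noncomputable def wtMap : Poly K d →ₗ[K] (Fin d → K) :=
  (basisMonomials (Fin d ⊕ Fin d) K).constr K fun m i =>
    wt (degY m) (degZ m) (m (Sum.inl i) : K) (m (Sum.inr i))

theorem wtMap_monomial (m : Fin d ⊕ Fin d →₀ ℕ) (i : Fin d) :
    wtMap (monomial m (1 : K)) i =
      wt (degY m) (degZ m) (m (Sum.inl i) : K) (m (Sum.inr i)) := by
  have := (basisMonomials (Fin d ⊕ Fin d) K).constr_basis K (fun m (i : Fin d) =>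
    wt (degY m) (degZ m) (m (Sum.inl i) : K) (m (Sum.inr i))) m
  rw [coe_basisMonomials] at this
  exact congrFun this i

theorem eq_zero_of_monomial {V : Type*} [AddCommGroup V] [Module K V] {σ : Type*}
    (f : MvPolynomial σ K →ₗ[K] V) (h : ∀ m, f (monomial m 1) = 0) (p : MvPolynomial σ K) :
    f p = 0 := by
  have : f = 0 := (basisMonomials σ K).ext fun m => by
    rw [coe_basisMonomials]; exact h m
  rw [this]; rfl

/-- `cubicForm` as a function of the pairs `(toY g, toZ g)`. -/
noncomputable def pairForm (p q r : Poly K d × Poly K d) : Poly K d :=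
  p.1 * q.1 * r.2 + p.1 * r.1 * q.2 + q.1 * r.1 * p.2 + p.1 * q.2 * r.2 + q.1 * p.2 * r.2 +
    r.1 * p.2 * q.2

variable (K d) in
/-- The pairs `(toY g, toZ g)` for the monomials `g` of `G_d`. -/
def monomialPairs : Set (Poly K d × Poly K d) :=
  {p | ∃ μ ν : Fin d ⊕ Fin d →₀ ℕ, p = (monomial μ 1, monomial ν 1) ∧
    ∀ i, IsPairing (degY μ) (degZ μ) (degY ν) (degZ ν) (μ (Sum.inl i) : K) (μ (Sum.inr i))
      (ν (Sum.inl i)) (ν (Sum.inr i))}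

theorem toY_toZ_mem_span (g : G K d) :
    (g.toY, g.toZ) ∈ Submodule.span K (monomialPairs K d) := by
  have e : (g.toY, g.toZ) = ∑ i, g.lin i • (y K i, z K i) +
      ∑ m ∈ g.poly.support, coeff m g.poly • (monomial m (1 : K), monomial m (1 : K)) := by
    have h : ∑ m ∈ g.poly.support, coeff m g.poly • monomial m (1 : K) = g.poly := by
      conv_rhs => rw [g.poly.as_sum]
      simp [smul_monomial]
    ext1 <;> simp [Prod.fst_sum, Prod.snd_sum, h, toY_def, toZ_def]
  rw [e]
  refine add_mem (sum_mem fun i _ => Submodule.smul_mem _ _ (Submodule.subset_span ?_))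
    (sum_mem fun m hm => Submodule.smul_mem _ _ (Submodule.subset_span ?_))
  · refine ⟨_, _, rfl, fun j => Or.inl ?_⟩
    simp [degY_single_inl, degY_single_inr, degZ_single_inl, degZ_single_inr, Finsupp.single_apply]
  · refine ⟨_, _, rfl, fun j => Or.inr ⟨rfl, rfl, rfl, rfl, ?_⟩⟩
    obtain ⟨i, j, m', rfl⟩ := exists_of_mem_sq g.poly_mem (mem_support_iff.1 hm)
    simp only [degY_add, degZ_add, degY_single_inl, degY_single_inr, degZ_single_inl,
      degZ_single_inr]
    omega

theorem wtMap_mul_pairForm_of_span (s : Poly K d) {q r : Poly K d × Poly K d}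
    (h : ∀ p ∈ monomialPairs K d, wtMap (s * pairForm p q r) = 0) {p : Poly K d × Poly K d}
    (hp : p ∈ Submodule.span K (monomialPairs K d)) : wtMap (s * pairForm p q r) = 0 := by
  induction hp using Submodule.span_induction with
  | mem p hp => exact h p hp
  | zero => simp [pairForm]
  | add p p' _ _ hp hp' =>
    have e : s * pairForm (p + p') q r = s * pairForm p q r + s * pairForm p' q r := by
      simp only [pairForm, Prod.fst_add, Prod.snd_add]; ring
    rw [e, map_add, hp, hp', add_zero]
  | smul c p _ hp =>
    have e : s * pairForm (c • p) q r = c • (s * pairForm p q r) := by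
      simp only [pairForm, Prod.smul_fst, Prod.smul_snd, smul_eq_C_mul]; ring
    rw [e, map_smul, hp, smul_zero]

theorem cast_eq_zero_of_degY {m : Fin d ⊕ Fin d →₀ ℕ} (h : degY m = 0) (i : Fin d) :
    (m (Sum.inl i) : K) = 0 := by
  rw [degY, Finset.sum_eq_zero_iff] at h
  rw [h i (Finset.mem_univ i), Nat.cast_zero]

theorem cast_eq_zero_of_degZ {m : Fin d ⊕ Fin d →₀ ℕ} (h : degZ m = 0) (i : Fin d) :
    (m (Sum.inr i) : K) = 0 := by
  rw [degZ, Finset.sum_eq_zero_iff] at h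
  rw [h i (Finset.mem_univ i), Nat.cast_zero]

theorem wtMap_monomial_mul_pairForm (m : Fin d ⊕ Fin d →₀ ℕ) {p q r : Poly K d × Poly K d}
    (hp : p ∈ monomialPairs K d) (hq : q ∈ monomialPairs K d) (hr : r ∈ monomialPairs K d) :
    wtMap (monomial m 1 * pairForm p q r) = 0 := by
  obtain ⟨μ₁, ν₁, rfl, h₁⟩ := hp
  obtain ⟨μ₂, ν₂, rfl, h₂⟩ := hq
  obtain ⟨μ₃, ν₃, rfl, h₃⟩ := hr
  funext i
  simp only [pairForm, mul_add, monomial_mul, one_mul, map_add, Pi.add_apply, wtMap_monomial,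
    degY_add, degZ_add, Finsupp.add_apply, Nat.cast_add, Pi.zero_apply]
  exact wt_cubicForm (fun h => cast_eq_zero_of_degY h i) (fun h => cast_eq_zero_of_degZ h i)
    (h₁ i) (h₂ i) (h₃ i)

theorem wtMap_mul_cubicForm (s : Poly K d) (g₁ g₂ g₃ : G K d) :
    wtMap (s * cubicForm g₁ g₂ g₃) = 0 := by
  have e : cubicForm g₁ g₂ g₃ =
      pairForm (g₁.toY, g₁.toZ) (g₂.toY, g₂.toZ) (g₃.toY, g₃.toZ) := by
    simp only [cubicForm, pairForm]
  rw [e, ← LinearMap.mulRight_apply K, ← LinearMap.comp_apply]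
  refine eq_zero_of_monomial _ (fun m => ?_) s
  rw [LinearMap.comp_apply, LinearMap.mulRight_apply]
  -- The form is symmetric, so each argument in turn can be moved to the first slot and reduced to a
  -- monomial pair there.
  have comm : ∀ p q r : Poly K d × Poly K d, pairForm p q r = pairForm q p r := fun p q r => by
    simp only [pairForm]; ring
  have rot : ∀ p q r : Poly K d × Poly K d, pairForm p q r = pairForm r p q := fun p q r => by
    simp only [pairForm]; ring
  refine wtMap_mul_pairForm_of_span _ (fun p hp => ?_) (toY_toZ_mem_span g₁)
  rw [comm]
  refine wtMap_mul_pairForm_of_span _ (fun q hq => ?_) (toY_toZ_mem_span g₂)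
  rw [rot]
  refine wtMap_mul_pairForm_of_span _ (fun r hr => ?_) (toY_toZ_mem_span g₃)
  exact wtMap_monomial_mul_pairForm m hr hq hp

theorem wtMap_rename (σ : Equiv.Perm (Fin d)) (p : Poly K d) (i : Fin d) :
    wtMap (rename (Sum.map σ σ) p) (σ i) = wtMap p i := by
  rw [← sub_eq_zero]
  let f : Poly K d →ₗ[K] K := LinearMap.proj (σ i) ∘ₗ wtMap ∘ₗ (rename (Sum.map σ σ)).toLinearMap -
    LinearMap.proj i ∘ₗ wtMap
  change f p = 0
  refine eq_zero_of_monomial f (fun m => ?_) p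
  have hinj : Function.Injective (Sum.map σ σ) := σ.injective.sumMap σ.injective
  have hl : ∀ j, Finsupp.mapDomain (Sum.map σ σ) m (Sum.inl (σ j)) = m (Sum.inl j) := fun j =>
    Finsupp.mapDomain_apply hinj m (Sum.inl j)
  have hr : ∀ j, Finsupp.mapDomain (Sum.map σ σ) m (Sum.inr (σ j)) = m (Sum.inr j) := fun j =>
    Finsupp.mapDomain_apply hinj m (Sum.inr j)
  have hY : degY (Finsupp.mapDomain (Sum.map σ σ) m) = degY m := by
    rw [degY, ← Equiv.sum_comp σ]; simp only [hl, degY]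
  have hZ : degZ (Finsupp.mapDomain (Sum.map σ σ) m) = degZ m := by
    rw [degZ, ← Equiv.sum_comp σ]; simp only [hr, degZ]
  change wtMap (rename (Sum.map σ σ) (monomial m (1 : K))) (σ i) - wtMap (monomial m (1 : K)) i = 0
  rw [rename_monomial, wtMap_monomial, wtMap_monomial, hl, hr, hY, hZ, sub_self]

/-- This places `weightForm` in the span of the differences X_p - X_q. -/
theorem sum_wtMap (p : Poly K d) : ∑ i, wtMap p i = 0 := by
  let f : Poly K d →ₗ[K] K := (∑ i, LinearMap.proj i) ∘ₗ wtMap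
  have e : ∑ i, wtMap p i = f p := by simp [f]
  rw [e]
  refine eq_zero_of_monomial f (fun m => ?_) p
  have hY : ((degY m : ℕ) : K) = ∑ i, (m (Sum.inl i) : K) := by rw [degY, Nat.cast_sum]
  have hZ : ((degZ m : ℕ) : K) = ∑ i, (m (Sum.inr i) : K) := by rw [degZ, Nat.cast_sum]
  have e : f (monomial m 1) = ∑ i, wt (degY m) (degZ m) (m (Sum.inl i) : K) (m (Sum.inr i)) := by
    simp [f, wtMap_monomial]
  rw [e]
  unfold wt
  split_ifs with h₁ h₂ h₃
  · rw [Finset.sum_sub_distrib, ← Finset.mul_sum, ← hY, ← hZ, h₁.1, h₁.2]; norm_num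
  · rw [Finset.sum_sub_distrib, ← hY, ← hZ, h₂.1, h₂.2]; norm_num
  · rw [Finset.sum_sub_distrib, ← Finset.mul_sum, ← hY, ← hZ, h₃.1, h₃.2]; norm_num
  · simp

variable [CharZero K]

theorem wtMap_of_mem_cubicIdeal {p : Poly K d} (hp : p ∈ cubicIdeal K d) : wtMap p = 0 := by
  -- The arbitrary multiplier carries the induction through ideal multiples.
  suffices ∀ s : Poly K d, wtMap (s * p) = 0 by simpa using this 1
  induction hp using Submodule.span_induction with
  | mem p hp =>
    obtain ⟨g, rfl⟩ := hp
    intro s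
    have e : s * cubicForm g g g = (3 : K) • (s * cubic g) := by
      rw [smul_eq_C_mul, map_ofNat C 3, cubicForm, cubic]; ring
    have h := wtMap_mul_cubicForm s g g g
    rw [e, map_smul] at h
    exact (smul_eq_zero.1 h).resolve_left three_ne_zero
  | zero => simp
  | add p q _ _ hp hq => intro s; rw [mul_add, map_add, hp, hq, add_zero]
  | smul c p _ hp => intro s; rw [smul_eq_mul, ← mul_assoc]; exact hp _

theorem toGU_hwv_ne_zero {α : K} (hα : α ≠ 0) (hd : 2 ≤ d) :
    toGU K d α α (hwv K hd 3 1 2 one_pos) ≠ 0 := by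
  intro h
  have h₁ := ((mem_tIdeal_identityU hα).1 ((Submodule.Quotient.mk_eq_zero _).1 h)).2
  let i : Fin d := ⟨0, by omega⟩
  let j : Fin d := ⟨1, by omega⟩
  have hij : i ≠ j := by simp [i, j]
  have e : (hwv K hd 3 1 2 one_pos).poly =
      monomial (Finsupp.single (Sum.inl i) 3 + Finsupp.single (Sum.inr j) 1) 1 -
      monomial (Finsupp.single (Sum.inl i) 2 + Finsupp.single (Sum.inl j) 1 +
        Finsupp.single (Sum.inr i) 1) 1 := by
    have : (hwv K hd 3 1 2 one_pos).poly =
      y K i ^ 2 * (y K i * z K j - y K j * z K i) ^ 1 * z K i ^ 0 := rfl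
    rw [this]
    simp only [X, monomial_pow, monomial_mul, pow_one, pow_zero, mul_one, mul_sub, one_pow]
    congr 2
    · rw [← add_assoc, ← Finsupp.smul_single_one, ← Finsupp.smul_single_one _ 3]
      congr 1
      module
    · simp [add_assoc]
  -- At the second index y_1³z_2 has weight 3 and y_1²y_2z_1 has weight -1, so the difference has
  -- weight 4.
  have h₂ := congrFun (wtMap_of_mem_cubicIdeal h₁) j
  rw [e, map_sub, Pi.sub_apply, wtMap_monomial, wtMap_monomial] at h₂
  simp [degY_add, degZ_add, degY_single_inl, degY_single_inr, degZ_single_inl, degZ_single_inr, wt,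
    hij] at h₂
  norm_num at h₂

end

open MvPolynomial G

section

variable {K : Type*} [Field K]

/-! ### The Specht module of the partition `(3,1)` -/

/-- Only the first column of (3,1) has two cells, so the product has a single factor. -/
theorem spechtPoly_shape31 (T : Fin 4 ≃ shape31.cells) {p q : Fin 4} (hp : (T p).1 = (0, 0))
    (hq : (T q).1 = (1, 0)) : (spechtPoly T : MvPolynomial (Fin 4) K) = X p - X q := by
  have h : (Finset.univ.filter fun pq : Fin 4 × Fin 4 =>
      (T pq.1).1.2 = (T pq.2).1.2 ∧ (T pq.1).1.1 < (T pq.2).1.1) = {(p, q)} := by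
    ext ⟨r, s⟩
    simp only [Finset.mem_filter, Finset.mem_univ, true_and, Finset.mem_singleton, Prod.mk.injEq]
    constructor
    · rintro ⟨h₁, h₂⟩
      have hc : ∀ c ∈ shape31.cells, c = (0, 0) ∨ c = (0, 1) ∨ c = (0, 2) ∨ c = (1, 0) := by
        decide
      have hr := hc _ (T r).2
      have hs := hc _ (T s).2
      have h3 : (T r).1 = (0, 0) ∧ (T s).1 = (1, 0) := by
        rcases hr with hr | hr | hr | hr <;> rcases hs with hs | hs | hs | hs <;>
          simp_all
      exact ⟨T.injective (Subtype.ext (h3.1.trans hp.symm)),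
        T.injective (Subtype.ext (h3.2.trans hq.symm))⟩
    · rintro ⟨rfl, rfl⟩
      rw [hp, hq]
      simp
  rw [spechtPoly, h, Finset.prod_singleton]

theorem exists_tableau {p q : Fin 4} (hpq : p ≠ q) :
    ∃ T : Fin 4 ≃ shape31.cells, (T p).1 = (0, 0) ∧ (T q).1 = (1, 0) := by
  let t : Fin 4 → shape31.cells := ![⟨(0, 0), by decide⟩, ⟨(1, 0), by decide⟩,
    ⟨(0, 1), by decide⟩, ⟨(0, 2), by decide⟩]
  have ht : Function.Bijective t := by
    rw [Fintype.bijective_iff_injective_and_card]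
    exact ⟨by decide, by decide⟩
  obtain ⟨σ, h0, h1⟩ : ∃ σ : Equiv.Perm (Fin 4), σ p = 0 ∧ σ q = 1 := by
    revert p q; decide
  refine ⟨σ.trans (Equiv.ofBijective t ht), ?_, ?_⟩
  · simp [h0, t]
  · simp [h1, t]

theorem X_sub_X_mem_spechtModule (p q : Fin 4) :
    (X p - X q : MvPolynomial (Fin 4) K) ∈ spechtModule K shape31 4 := by
  by_cases hpq : p = q
  · rw [hpq, sub_self]; exact zero_mem _
  · obtain ⟨T, hp, hq⟩ := exists_tableau hpq
    exact Submodule.subset_span ⟨T, spechtPoly_shape31 T hp hq⟩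

theorem spechtModule_shape31_le {S : Submodule K (MvPolynomial (Fin 4) K)}
    (h : ∀ p q : Fin 4, X p - X q ∈ S) : spechtModule K shape31 4 ≤ S := by
  refine Submodule.span_le.2 ?_
  rintro _ ⟨T, rfl⟩
  let p := T.symm ⟨(0, 0), by decide⟩
  let q := T.symm ⟨(1, 0), by decide⟩
  have e := spechtPoly_shape31 (K := K) T (p := p) (q := q) (by simp [p]) (by simp [q])
  change spechtPoly T ∈ S
  rw [e]
  exact h p q

/-! ### The multilinear component of degree four -/

variable (K) in
/-- The linear map `G_4 → K[X_1, …, X_4]` given by the weights of the indices. -/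
noncomputable def weightForm : G K 4 →ₗ[K] MvPolynomial (Fin 4) K where
  toFun a := ∑ i, wtMap a.poly i • X i
  map_add' a b := by
    simp only [poly_add, map_add, Pi.add_apply, add_smul, Finset.sum_add_distrib]
  map_smul' c a := by
    simp only [poly_smul, map_smul, Pi.smul_apply, smul_eq_mul, mul_smul, Finset.smul_sum,
      RingHom.id_apply]

theorem weightForm_apply (a : G K 4) : weightForm K a = ∑ i, wtMap a.poly i • X i := rfl

theorem weightForm_mem_spechtModule (a : G K 4) :
    weightForm K a ∈ spechtModule K shape31 4 := by
  have e : weightForm K a = ∑ i, wtMap a.poly i • (X i - X 0) := by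
    simp only [smul_sub, Finset.sum_sub_distrib, ← Finset.sum_smul, sum_wtMap, zero_smul, sub_zero,
      weightForm_apply]
  rw [e]
  exact sum_mem fun i _ => Submodule.smul_mem _ _ (X_sub_X_mem_spechtModule i 0)

theorem weightForm_permG (σ : Equiv.Perm (Fin 4)) (a : G K 4) :
    weightForm K (permG K σ a) = rename σ (weightForm K a) := by
  rw [weightForm_apply, weightForm_apply, map_sum, ← Equiv.sum_comp σ]
  refine Finset.sum_congr rfl fun i _ => ?_
  have e : (permG K σ a).poly = rename (Sum.map σ σ) a.poly := rfl
  rw [e, wtMap_rename, map_smul, rename_X]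

theorem wtMap_eq_zero_of_weightForm {a : G K 4} (h : weightForm K a = 0) : wtMap a.poly = 0 := by
  funext i
  have h₁ := congrArg (coeff (Finsupp.single i 1)) h
  rw [weightForm_apply, coeff_sum] at h₁
  simpa [coeff_X, Finsupp.single_left_inj] using h₁

/-- The product of the `y_i` over the `i` with `s i`, and of the `z_i` over the other `i`. -/
noncomputable def sqfree {d : ℕ} (s : Fin d → Bool) : Poly K d :=
  ∏ i, if s i then y K i else z K i

/-- The exponent of `sqfree s`. -/
noncomputable def sqfreeExp {d : ℕ} (s : Fin d → Bool) : Fin d ⊕ Fin d →₀ ℕ :=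
  Finsupp.equivFunOnFinite.symm
    (Sum.elim (fun i => if s i then 1 else 0) fun i => if s i then 0 else 1)

theorem sqfreeExp_inl {d : ℕ} (s : Fin d → Bool) (i : Fin d) :
    sqfreeExp s (Sum.inl i) = if s i then 1 else 0 := rfl

theorem sqfreeExp_inr {d : ℕ} (s : Fin d → Bool) (i : Fin d) :
    sqfreeExp s (Sum.inr i) = if s i then 0 else 1 := rfl

theorem sqfree_eq_monomial {d : ℕ} (s : Fin d → Bool) :
    (sqfree s : Poly K d) = monomial (sqfreeExp s) 1 := by
  rw [monomial_eq, C_1, one_mul, Finsupp.prod_fintype _ _ fun _ => pow_zero _,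
    Fintype.prod_sum_type, ← Finset.prod_mul_distrib, sqfree]
  refine Finset.prod_congr rfl fun i _ => ?_
  rw [sqfreeExp_inl, sqfreeExp_inr]
  split_ifs <;> simp

theorem wtMap_sqfree {d : ℕ} (s : Fin d → Bool) (i : Fin d) :
    wtMap (sqfree s : Poly K d) i = wt (∑ j, if s j then 1 else 0) (∑ j, if s j then 0 else 1)
      (if s i then 1 else 0) (if s i then 0 else 1) := by
  rw [sqfree_eq_monomial, wtMap_monomial, degY, degZ]
  simp only [sqfreeExp_inl, sqfreeExp_inr, Nat.cast_ite, Nat.cast_one, Nat.cast_zero]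

theorem exists_sqfreeExp {d : ℕ} {m : Fin d ⊕ Fin d →₀ ℕ}
    (h : ∀ i, m (Sum.inl i) + m (Sum.inr i) = 1) : ∃ s, m = sqfreeExp s := by
  refine ⟨fun i => decide (m (Sum.inl i) = 1), ?_⟩
  ext (i | i)
  · rw [sqfreeExp_inl]
    have := h i
    by_cases h1 : m (Sum.inl i) = 1
    · simp [h1]
    · simp [h1]; omega
  · rw [sqfreeExp_inr]
    have := h i
    by_cases h1 : m (Sum.inl i) = 1
    · simp [h1]; omega
    · simp [h1]; omega

theorem sqfree_mem_sq {d : ℕ} {s : Fin d → Bool} {i j : Fin d} (hi : s i = true)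
    (hj : s j = false) : (sqfree s : Poly K d) ∈ sq K d := by
  have hij : i ≠ j := by rintro rfl; simp [hi] at hj
  rw [sqfree, ← Finset.mul_prod_erase _ _ (Finset.mem_univ i),
    ← Finset.mul_prod_erase _ _ (Finset.mem_erase.2 ⟨hij.symm, Finset.mem_univ j⟩), ← mul_assoc,
    if_pos hi, if_neg (by simp [hj])]
  exact Ideal.mul_mem_right _ _ (y_mul_z_mem_sq i j)

variable (K) in
/-- The monomial `z_i ∏_{j ≠ i} y_j`. -/
noncomputable def yyyz (i : Fin 4) : Poly K 4 := sqfree fun j => decide (j ≠ i)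

/-- The weights of a multilinear monomial determine it modulo the relations: for T_k the right-hand
side is 4T_k minus the vanishing sum of all T_i. The fourteen remaining cases are the choices of y
or z that use both letters. -/
theorem CubicRel.four_mul_prod {Q : Type*} [CommRing Q] {y z : Fin 4 → Q} (h : CubicRel y z)
    (φ : K →+* Q) (s : Fin 4 → Bool) (ht : ∃ i, s i = true) (hf : ∃ i, s i = false) :
    4 * ∏ i, (if s i then y i else z i) =
      ∑ i, φ (wt (∑ j, if s j then 1 else 0) (∑ j, if s j then 0 else 1)
        (if s i then 1 else 0) (if s i then 0 else 1)) *
          ∏ j, if decide (j ≠ i) then y j else z j := by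
  have E := h.sum_yyyz 0 1 2 3
  have h3 : φ 3 = 3 := map_ofNat φ 3
  simp only [Fin.exists_fin_succ, IsEmpty.exists_iff, or_false] at ht hf
  simp only [Fin.prod_univ_four, Fin.sum_univ_four]
  change s 0 = true ∨ s 1 = true ∨ s 2 = true ∨ s 3 = true at ht
  change s 0 = false ∨ s 1 = false ∨ s 2 = false ∨ s 3 = false at hf
  revert ht hf
  generalize s 0 = s0
  generalize s 1 = s1
  generalize s 2 = s2
  generalize s 3 = s3
  intro ht hf
  rcases s0 <;> rcases s1 <;> rcases s2 <;> rcases s3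
  case false.false.false.false => simp at ht
  case true.true.true.true => simp at hf
  all_goals simp [wt, h3]
  · linear_combination 4 * h.yyyz_add_yzzz 3 0 1 2 - E
  · linear_combination 4 * h.yyyz_add_yzzz 2 0 1 3 - E
  · linear_combination 2 * h.two_yyzz 2 3 0 1 + E
  · linear_combination 4 * h.yyyz_add_yzzz 1 0 2 3 - E
  · linear_combination 2 * h.two_yyzz 1 3 0 2 + E
  · linear_combination 2 * h.two_yyzz 1 2 0 3 + E
  · linear_combination E
  · linear_combination 4 * h.yyyz_add_yzzz 0 1 2 3 - E
  · linear_combination 2 * h.two_yyzz 0 3 1 2 + E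
  · linear_combination 2 * h.two_yyzz 0 2 1 3 + E
  · linear_combination E
  · linear_combination 2 * h.two_yyzz 0 1 2 3 + E
  · linear_combination E
  · linear_combination E

theorem four_mul_sqfree_sub_mem [CharZero K] (s : Fin 4 → Bool) (ht : ∃ i, s i = true) (hf : ∃ i, s i = false) :
    (4 : K) • sqfree s - ∑ i, wtMap (sqfree s : Poly K 4) i • yyyz K i ∈ cubicIdeal K 4 := by
  have h := (cubicRel (le_refl (cubicIdeal K 4))).four_mul_prod
    ((Ideal.Quotient.mk (cubicIdeal K 4)).comp C) s ht hf
  rw [← Ideal.Quotient.eq_zero_iff_mem, map_sub, sub_eq_zero, map_sum]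
  have e : ∀ t : Fin 4 → Bool, Ideal.Quotient.mk (cubicIdeal K 4) (sqfree t) =
      ∏ i, if t i then Ideal.Quotient.mk (cubicIdeal K 4) (y K i) else
        Ideal.Quotient.mk (cubicIdeal K 4) (z K i) := fun t => by
    rw [sqfree, map_prod]
    exact Finset.prod_congr rfl fun i _ => apply_ite _ _ _ _
  simp only [smul_eq_C_mul, map_mul, yyyz, e, wtMap_sqfree]
  rw [map_ofNat C 4, map_ofNat]
  exact h

theorem four_smul_poly_sub_mem [CharZero K] {a : G K 4} (ha : a ∈ multilinG K 4) :
    (4 : K) • a.poly - ∑ i, wtMap a.poly i • yyyz K i ∈ cubicIdeal K 4 := by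
  let f : Poly K 4 →ₗ[K] Poly K 4 :=
    { toFun := fun p => (4 : K) • p - ∑ i, wtMap p i • yyyz K i
      map_add' := fun p q => by
        simp only [map_add, Pi.add_apply, add_smul, Finset.sum_add_distrib, smul_add]; ring
      map_smul' := fun c p => by
        simp only [map_smul, Pi.smul_apply, smul_eq_mul, mul_smul, ← Finset.smul_sum, smul_sub,
          RingHom.id_apply]
        rw [smul_comm] }
  change a.poly ∈ ((cubicIdeal K 4).restrictScalars K).comap f
  rw [a.poly.as_sum]
  refine Submodule.sum_mem _ fun m hm => ?_
  rw [mem_support_iff] at hm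
  obtain ⟨s, rfl⟩ := exists_sqfreeExp (ha.2 m hm)
  -- Membership in `sq` excludes the monomials with only y's or only z's.
  obtain ⟨i, j, m', e⟩ := exists_of_mem_sq a.poly_mem hm
  have hi := congrArg (fun m => m (Sum.inl i)) e
  have hj := congrArg (fun m => m (Sum.inr j)) e
  simp only [sqfreeExp_inl, sqfreeExp_inr, Finsupp.add_apply, Finsupp.single_eq_same] at hi hj
  have e' : monomial (sqfreeExp s) (coeff (sqfreeExp s) a.poly) =
      coeff (sqfreeExp s) a.poly • sqfree s := by
    rw [sqfree_eq_monomial, smul_monomial, smul_eq_mul, mul_one]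
  rw [e']
  refine Submodule.smul_mem _ _ (four_mul_sqfree_sub_mem s ⟨i, ?_⟩ ⟨j, ?_⟩)
  · by_contra h
    rw [if_neg h] at hi
    omega
  · rw [← Bool.not_eq_true]
    intro h
    rw [if_pos h] at hj
    omega

theorem mem_cubicIdeal_of_weightForm [CharZero K] {a : G K 4} (ha : a ∈ multilinG K 4)
    (h : weightForm K a = 0) : a.poly ∈ cubicIdeal K 4 := by
  have h₁ := four_smul_poly_sub_mem ha
  rw [wtMap_eq_zero_of_weightForm h] at h₁
  simp only [Pi.zero_apply, zero_smul, Finset.sum_const_zero, sub_zero, smul_eq_C_mul] at h₁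
  exact mem_of_C_mul_mem (by norm_num) h₁

theorem yyyz_mem_sq (i : Fin 4) : yyyz K i ∈ sq K 4 :=
  sqfree_mem_sq (i := i + 1) (j := i) (by revert i; decide) (by simp)

theorem ofPoly_yyyz_mem_multilinG (i : Fin 4) :
    ofPoly (yyyz K i) (yyyz_mem_sq i) ∈ multilinG K 4 := by
  refine ⟨fun _ => rfl, fun m hm j => ?_⟩
  rw [poly_ofPoly, yyyz, sqfree_eq_monomial, coeff_monomial] at hm
  obtain rfl := (ite_ne_right_iff.1 hm).1
  rw [sqfreeExp_inl, sqfreeExp_inr]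
  split_ifs <;> rfl

theorem weightForm_yyyz (i : Fin 4) :
    weightForm K (ofPoly (yyyz K i) (yyyz_mem_sq i)) = (4 : K) • X i - ∑ j, X j := by
  rw [weightForm_apply, poly_ofPoly, yyyz]
  simp only [wtMap_sqfree]
  fin_cases i <;> simp [Fin.sum_univ_four, wt, smul_eq_C_mul, map_ofNat C] <;> ring

theorem tIdeal_le_ker_weightForm [CharZero K] {α : K} (hα : α ≠ 0) :
    tIdeal K (identityU K 4 α α) ≤ LinearMap.ker (weightForm K) := fun a ha => by
  rw [LinearMap.mem_ker, weightForm_apply,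
    wtMap_of_mem_cubicIdeal ((mem_tIdeal_identityU hα).1 ha).2]
  simp

/-- The linear map induced by `weightForm` on `G_4(U_α)`. -/
noncomputable def weightFormGU [CharZero K] {α : K} (hα : α ≠ 0) : GU K 4 α α →ₗ[K] MvPolynomial (Fin 4) K :=
  (tIdeal K (identityU K 4 α α)).liftQ (weightForm K) (tIdeal_le_ker_weightForm hα)

theorem weightFormGU_toGU [CharZero K] {α : K} (hα : α ≠ 0) (a : G K 4) :
    weightFormGU hα (toGU K 4 α α a) = weightForm K a := rfl

theorem weightFormGU_mem [CharZero K] {α : K} (hα : α ≠ 0) :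
    ∀ f ∈ multilinGU K α α 4, weightFormGU hα f ∈ spechtModule K shape31 4 := by
  rintro _ ⟨a, -, rfl⟩
  exact weightForm_mem_spechtModule a

theorem bijective_weightFormGU [CharZero K] {α : K} (hα : α ≠ 0) :
    Function.Bijective ((weightFormGU hα).restrict (weightFormGU_mem hα)) := by
  constructor
  · rw [← LinearMap.ker_eq_bot, eq_bot_iff]
    rintro ⟨_, a, ha, rfl⟩ h
    have h₁ : weightForm K a = 0 := congrArg Subtype.val h
    refine Subtype.ext ((Submodule.Quotient.mk_eq_zero _).2 ((mem_tIdeal_identityU hα).2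
      ⟨ha.1 (by norm_num), mem_cubicIdeal_of_weightForm ha h₁⟩))
  · rintro ⟨f, hf⟩
    have h : spechtModule K shape31 4 ≤ (multilinGU K α α 4).map (weightFormGU hα) := by
      refine spechtModule_shape31_le fun p q => ?_
      -- The image of T_p - T_q is 4(X_p - X_q), since the common sum of the X_j cancels.
      refine ⟨toGU K 4 α α ((4 : K)⁻¹ • (ofPoly (yyyz K p) (yyyz_mem_sq p) -
        ofPoly (yyyz K q) (yyyz_mem_sq q))), ⟨_, Submodule.smul_mem _ _ (sub_mem
          (ofPoly_yyyz_mem_multilinG p) (ofPoly_yyyz_mem_multilinG q)), rfl⟩, ?_⟩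
      rw [weightFormGU_toGU, map_smul, map_sub, weightForm_yyyz, weightForm_yyyz,
        sub_sub_sub_cancel_right, ← smul_sub, inv_smul_smul₀ (by norm_num)]
    obtain ⟨u, hu, rfl⟩ := h hf
    exact ⟨⟨u, hu⟩, rfl⟩

theorem cocharacter_four [CharZero K] {α : K} (hα : α ≠ 0) : cocharacter K α α 4 = irrChar K shape31 4 := by
  funext σ
  rw [cocharacter, irrChar, ← LinearMap.trace_conj' _ (LinearEquiv.ofBijective _
    (bijective_weightFormGU hα))]
  congr 1
  refine LinearMap.ext fun w => ?_
  obtain ⟨v, rfl⟩ := (LinearEquiv.ofBijective _ (bijective_weightFormGU hα)).surjective w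
  rw [LinearEquiv.conj_apply_apply, LinearEquiv.symm_apply_apply]
  obtain ⟨_, a, ha, rfl⟩ := v
  -- Equivariance of `weightForm` makes the two actions conjugate, so their traces agree.
  exact Subtype.ext (weightForm_permG σ a)

end

end Bicommutative

open Bicommutative in
theorem mainTheorem7 {K : Type*} [Field K] [CharZero K] (α₁ α₂ : K)
    (hα : (α₁, α₂) ≠ (0, 0)) (h : α₁ = α₂) :
    -- the cocharacters
    cocharacter K α₁ α₂ 4 = irrChar K shape31 4 ∧
    (∀ n : ℕ, 5 ≤ n → cocharacter K α₁ α₂ n = 0) ∧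
    -- an identity of degree 1, 2 or 3 implies all polynomials of the next degree
    (∀ d n : ℕ, n ∈ ({1, 2, 3} : Set ℕ) → ∀ f : GU K d α₁ α₂, HasDegree f n →
      homGU K d α₁ α₂ (n + 1) ≤ tIdeal K {f}) ∧
    -- the nonzero element `w_(3,1)^(2)` of degree 4 has no consequences of higher degree
    (∀ (d : ℕ) (hd : 2 ≤ d),
      toGU K d α₁ α₂ (hwv K hd 3 1 2 one_pos) ≠ 0 ∧
      ∀ m : ℕ, 4 < m →
        tIdeal K {toGU K d α₁ α₂ (hwv K hd 3 1 2 one_pos)} ⊓ homGU K d α₁ α₂ m = ⊥) := by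
  subst h
  have hα₁ : α₁ ≠ 0 := fun h => hα (by rw [h])
  refine ⟨cocharacter_four hα₁, fun n hn => cocharacter_eq_zero hα₁ hn,
    fun d n hn f hf => homGU_succ_le_tIdeal hα₁ hn hf,
    fun d hd => ⟨toGU_hwv_ne_zero hα₁ hd, fun m hm => ?_⟩⟩
  -- The entire component of degree m > 4 is zero, whatever the T-ideal.
  rw [homGU_eq_bot hα₁ hm, inf_bot_eq]
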